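/- **Theorem ($\ell_\infty$ mean estimation by the coordinate subsampled Gaussian mechanism with coordinate pre-selection).** *Algorithm.* Let $n,d\ge 1$, $c>0$, and let client $i\in\{1,\dots,n\}$ hold $x_i\in\{-c,c\}^d$; put $\mu=\frac1n\sum_{i=1}^n x_i$. Given an integer $1\le d'\le d$, a real $b>0$ with $\gamma:=b/d'\le 1$, and a noise level $\sigma^2\ge 0$, draw independently a uniformly random set $\mathcal J\subseteq\{1,\dots,d\}$ of $d'$ coordinates, $Z_{i,j}\sim\mathrm{Bern}(\gamma)$ and $W_j\sim N(0,\sigma^2)$. The set $\mathcal J$ and the $Z_{i,j}$ come from randomness shared by the clients and the server and hidden from the adversary. Client $i$ sends one bit, the sign of $x_i(j)$, for each $j\in\mathcal J$ with $Z_{i,j}=1$. The server outputs $\hat\mu\in\mathbb R^d$ with $$\hat\mu_j=\frac{d}{d'}\Big(\frac1{n\gamma}\sum_{i:\,Z_{i,j}=1}x_i(j)+W_j\Big)\ \text{ for } j\in\mathcal J,\qquad \hat\mu_j=0\ \text{ for } j\notin\mathcal J .$$ $(\varepsilon,\delta)$-differential privacy means $\Pr\{\hat\mu\in S\mid x^n\}\le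 e^{\varepsilon}\Pr\{\hat\mu\in S\mid x'^n\}+\delta$ for all measurable $S$ and all datasets $x^n,x'^n$ in $(\{-c,c\}^d)^n$ that differ in at most one $x_i$. *Claim.* For every $\delta_0<1$ there are constants $A,C>0$, depending only on $\delta_0$, such that the following holds for all integers $n,d\ge1$, all reals $b$ with $nb\ge 1$, $c>0$, $\varepsilon>0$, $0<\delta\le\delta_0$, and every integer $d'\in[1,d]$ with $b\le d'$ obtained by rounding (up or down, i.e. differing by less than $1$ from) $$\min\Big(d,\ nb,\ \frac{n^2\varepsilon^2}{(\log(1/\delta)+\varepsilon)\log(d/\delta)}\Big).$$ There is a noise level $\sigma^2\ge0$, depending only on these parameters and not on the data, with $$\sigma^2\le A\Big(\frac{c^2\log(1/\delta)}{n^2\gamma^2}+\frac{c^2d'(\log(d'/\delta)+\varepsilon)\log(d'/\delta)}{n^2\varepsilon^2}\Big),\qquad \gamma=\frac b{d'},$$ such that the algorithm run with $\sigma^2$ is $(\varepsilon,\delta)$-differentially private and, for all $x_1,\dots,x_n\in\{-c,c\}^d$: $\mathbb E[\hat\mu]=\mu$; the expected number of bits sent by each client is $\gamma d'=b$; and $$\mathbb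 E\|\hat\mu-\mu\|_2^2\le C\,c^2d^2\log\Big(\frac d\delta\Big)\max\Big(\frac1{nb},\ \frac{\log(1/\delta)+\varepsilon}{n^2\varepsilon^2}\Big).$$ -/

import Mathlib

open MeasureTheory ProbabilityTheory
open scoped NNReal ENNReal

noncomputable section

namespace CSGM

/-! ### Differential privacy -/

/-- Two datasets of `n` records are neighbouring if they agree except possibly in one record. -/
def Neighbours {n : ℕ} {X : Type*} (x x' : Fin n → X) : Prop :=
  ∃ i, ∀ k, k ≠ i → x k = x' k

/-- The randomized mechanism which, on the dataset `x`, outputs `M x ω` with `ω` drawn from `P`,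
is `(ε, δ)`-differentially private. -/
def IsDP {n : ℕ} {X Ω Y : Type*} [MeasurableSpace Ω] [MeasurableSpace Y]
    (ε δ : ℝ) (P : Measure Ω) (M : (Fin n → X) → Ω → Y) : Prop :=
  ∀ x x' : Fin n → X, Neighbours x x' → ∀ S : Set Y, MeasurableSet S →
    P {ω | M x ω ∈ S} ≤ ENNReal.ofReal (Real.exp ε) * P {ω | M x' ω ∈ S} + ENNReal.ofReal δ

/-! ### Data -/

/-- The data domain `{-c, c}^d`. -/
def signCube (d : ℕ) (c : ℝ) : Set (Fin d → ℝ) := {v | ∀ j, v j = -c ∨ v j = c}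

/-- The mean `μ = (1/n) ∑ᵢ xᵢ`. -/
def mean {n : ℕ} {ι : Type*} (x : Fin n → ι → ℝ) (j : ι) : ℝ := (1 / (n : ℝ)) * ∑ i, x i j

/-! ### The coordinate subsampled Gaussian mechanism (CSGM)

The coordinates are indexed by a finite type `ι`. -/

/-- The bit which represents a value `v ∈ {-c, c}`. -/
def encodeBit (v : ℝ) : Bool := decide (0 < v)

/-- The value in `{-c, c}` which a bit represents. -/
def decodeBit (c : ℝ) (β : Bool) : ℝ := if β then c else -c

/-- The message of a client with data `v`: one bit for every coordinate `j` with `z j = 1`, and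
nothing for the other coordinates. The selection `z` is drawn from randomness shared with the
server, so the server knows which coordinates the bits belong to. -/
def message {ι : Type*} (v : ι → ℝ) (z : ι → Bool) (j : ι) : Option Bool :=
  if z j then some (encodeBit (v j)) else none

/-- The number of bits of a message. -/
def bitCount {ι : Type*} [Fintype ι] (m : ι → Option Bool) : ℕ :=
  (Finset.univ.filter fun j => (m j).isSome = true).card

/-- The server's part of CSGM: from the messages `m i` of the clients and the noise vector `w`, it
computes `(1/(nγ)) ∑_{i : z i j = 1} x i j + w j` for every coordinate `j`. -/
def server {n : ℕ} {ι : Type*} (c γ : ℝ) (m : Fin n → ι → Option Bool) (w : ι → ℝ) (j : ι) : ℝ :=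
  (1 / ((n : ℝ) * γ)) * ∑ i, ((m i j).map (decodeBit c)).getD 0 + w j

/-- CSGM on data `x`, with selections `z` and noise `w`. -/
def csgm {n : ℕ} {ι : Type*} (c γ : ℝ) (x : Fin n → ι → ℝ)
    (z : Fin n → ι → Bool) (w : ι → ℝ) : ι → ℝ :=
  server c γ (fun i => message (x i) (z i)) w

/-- The law of the randomness of CSGM: the selections `z i j` are i.i.d. Bernoulli with parameter
`γ` (a real number in `[0, 1]`), the noises `w j` are i.i.d. `N(0, v)`, and all are independent. -/
def csgmRandomness (n : ℕ) (ι : Type*) [Fintype ι] (γ : ℝ) (v : ℝ≥0) :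
    Measure ((Fin n → ι → Bool) × (ι → ℝ)) :=
  (Measure.pi fun _ : Fin n => Measure.pi fun _ : ι =>
      bernoulliMeasure true false (Set.projIcc (0 : ℝ) 1 zero_le_one γ)).prod
    (Measure.pi fun _ : ι => gaussianReal 0 v)

/-! ### CSGM with coordinate pre-selection -/

/-- A realization `(J, z, w)` of the randomness of CSGM with coordinate pre-selection: the
pre-selected coordinates `J`, the selections `z` and the noise `w`. The entries of `z` and `w` at
coordinates outside `J` are never used. -/
abbrev Coins (n d : ℕ) : Type := Finset (Fin d) × (Fin n → Fin d → Bool) × (Fin d → ℝ)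

/-- The law of the randomness of CSGM with coordinate pre-selection: `J` is uniformly distributed
on the sets of `d'` coordinates and independent of the randomness of CSGM. -/
def preselectRandomness (n d d' : ℕ) (γ : ℝ) (v : ℝ≥0) : Measure (Coins n d) :=
  (uniformOn {J : Finset (Fin d) | J.card = d'}).prod (csgmRandomness n (Fin d) γ v)

/-- The message of client `i` in CSGM with coordinate pre-selection, a message on the coordinates
in `J`. -/
def preselectMessage {n d : ℕ} (x : Fin n → Fin d → ℝ) (ω : Coins n d) (i : Fin n) :
    {j // j ∈ ω.1} → Option Bool :=
  message (fun j => x i j) (fun j => ω.2.1 i j)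

/-- CSGM with coordinate pre-selection, run with `γ = b / d'`: apply CSGM to the data restricted to
`J`, extend the result by `0` outside `J`, and multiply it by `d / d'`. -/
def preselect {n d : ℕ} (c b : ℝ) (d' : ℕ) (x : Fin n → Fin d → ℝ) (ω : Coins n d)
    (j : Fin d) : ℝ :=
  ((d : ℝ) / d') *
    if h : j ∈ ω.1 then
      csgm c (b / d') (fun i (k : {k // k ∈ ω.1}) => x i k) (fun i k => ω.2.1 i k)
        (fun k => ω.2.2 k) ⟨j, h⟩
    else 0

end CSGM

end

namespace CSGM

/-! ### The privacy loss of one coordinate -/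

/-! The substance is the privacy bound. Fix `J` and the selections of all clients but client `i`.
The output is then a fixed function of a vector with independent coordinates: the noise plus, with
probability `γ`, a shift by the signed contribution of client `i`. Neighbouring datasets share this
function and differ only in the signs of the shifts. After rescaling, a coordinate has density
`mixDensity γ w (±1)` with respect to `N(0, w)`, where `w = (c / (nγ))² / σ²`. Averaging over the
conditioning preserves the privacy inequality.

For one coordinate with flipped sign, the densities at `y ≥ 0` are `p = mixDensity γ w 1 y` and `q =
mixDensity γ w 1 (-y)`, and `log (p / q) ≤ 4γ y e^y` (`mixDensity_le_exp_mul`). The loss is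
truncated to `|y| ≤ R`. Pairing `y` with `-y` cancels the first-order term, and the truncated moment
of order `l` of the likelihood ratio is `exp (O(w γ² l (l + 1)))`. Over `k = d'` coordinates the
moments multiply, Markov's inequality controls large total losses, and a union bound controls the
truncated tails (`pi_withDensity_le`, `pi_mixture_le`).

The truncation level depends on the regime (`exists_truncation`). If `log (k/δ)` is comparable to
the noise scale, `R = 1` suffices, and the loss is linear in `y`. Otherwise `γ` is so small compared
with `ε / √k` that `R = (log k) / 8` is affordable: the truncated loss times `l` stays bounded, and
a second-order expansion applies (`lintegral_ratio_rpow_le_of_bounded`). The minimum in `noiseScale`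
reflects these two regimes.

Accuracy is an exact second-moment computation (`integral_preselect_sub_sq`): sampling variance,
noise variance and the variance of pre-selection. The choice of `d'` balances them (`round_bounds`,
`sq_error_bound`). -/

/-- The density, with respect to `N(0, w)`, of the mixture `(1 - γ) N(0, w) + γ N(t w, w)`. -/
noncomputable def mixDensity (γ w t y : ℝ) : ℝ := 1 - γ + γ * Real.exp (t * y - t ^ 2 * w / 2)

lemma mixDensity_zero (γ w y : ℝ) : mixDensity γ w 0 y = 1 := by simp [mixDensity]

lemma mixDensity_neg (γ w t y : ℝ) : mixDensity γ w (-t) y = mixDensity γ w t (-y) := by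
  simp [mixDensity]

lemma mixDensity_pos {γ : ℝ} (h0 : 0 ≤ γ) (h1 : γ ≤ 1) (w t y : ℝ) : 0 < mixDensity γ w t y := by
  unfold mixDensity
  rcases h1.lt_or_eq with h | rfl
  · have := Real.exp_pos (t * y - t ^ 2 * w / 2); nlinarith [mul_nonneg h0 this.le]
  · simp [Real.exp_pos]

@[fun_prop]
lemma measurable_mixDensity (γ w t : ℝ) : Measurable (mixDensity γ w t) := by
  unfold mixDensity; fun_prop

lemma mixDensity_neg_le {γ y : ℝ} (h0 : 0 ≤ γ) (hy : 0 ≤ y) (w : ℝ) :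
    mixDensity γ w 1 (-y) ≤ mixDensity γ w 1 y := by
  unfold mixDensity
  gcongr
  linarith

/-- Only the component of weight `γ` depends on the sign of `y`, and `1 - e^(-2y) ≤ 2y`. The factors
`γ` and `y` are what later make the first-order term of the moment quadratic in both. -/
lemma mixDensity_sub_le {γ w y : ℝ} (h0 : 0 ≤ γ) (hw : 0 ≤ w) (hy : 0 ≤ y) :
    mixDensity γ w 1 y - mixDensity γ w 1 (-y) ≤ γ * (2 * y * Real.exp y) := by
  have e1 : Real.exp (1 * y - 1 ^ 2 * w / 2) = Real.exp (-(w / 2)) * Real.exp y := by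
    rw [← Real.exp_add]; ring_nf
  have e2 : Real.exp (1 * -y - 1 ^ 2 * w / 2)
      = Real.exp (-(w / 2)) * Real.exp y * Real.exp (-(2 * y)) := by
    rw [← Real.exp_add, ← Real.exp_add]; ring_nf
  have e3 : 1 - 2 * y ≤ Real.exp (-(2 * y)) := by
    have := Real.add_one_le_exp (-(2 * y)); linarith
  have e4 : Real.exp (-(w / 2)) ≤ 1 := Real.exp_le_one_iff.2 (by linarith)
  have e5 := Real.exp_pos (-(w / 2))
  have : mixDensity γ w 1 y - mixDensity γ w 1 (-y)
      = γ * (Real.exp (-(w / 2)) * Real.exp y * (1 - Real.exp (-(2 * y)))) := by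
    unfold mixDensity; rw [e1, e2]; ring
  rw [this]
  refine mul_le_mul_of_nonneg_left ?_ h0
  calc Real.exp (-(w / 2)) * Real.exp y * (1 - Real.exp (-(2 * y)))
      ≤ Real.exp (-(w / 2)) * Real.exp y * (2 * y) := by gcongr; linarith
    _ ≤ 1 * Real.exp y * (2 * y) := by gcongr
    _ = _ := by ring

/-- For `γ ≤ 1/2` the smaller density is at least `1/2`, so the relative increment is at most twice
the absolute one. For `γ > 1/2` the ratio is at most `e^(2y)`, as for an unmixed Gaussian, and `2y ≤
4γy`. -/
lemma mixDensity_le_exp_mul {γ w y : ℝ} (h0 : 0 ≤ γ) (h1 : γ ≤ 1) (hw : 0 ≤ w) (hy : 0 ≤ y) :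
    mixDensity γ w 1 y ≤ mixDensity γ w 1 (-y) * Real.exp (4 * γ * y * Real.exp y) := by
  have hexp : 1 ≤ Real.exp y := Real.one_le_exp hy
  rcases le_or_gt γ (1 / 2) with h | h
  · have hq : 1 / 2 ≤ mixDensity γ w 1 (-y) := by
      unfold mixDensity; have := Real.exp_pos (1 * -y - 1 ^ 2 * w / 2)
      nlinarith [mul_nonneg h0 this.le]
    have hdiff := mixDensity_sub_le h0 hw hy
    have h3 := Real.add_one_le_exp (4 * γ * y * Real.exp y)
    have h4 : 0 ≤ 4 * γ * y * Real.exp y := by positivity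
    nlinarith
  · have h3 : mixDensity γ w 1 y ≤ mixDensity γ w 1 (-y) * Real.exp (2 * y) := by
      have : mixDensity γ w 1 (-y) * Real.exp (2 * y)
          = (1 - γ) * Real.exp (2 * y) + γ * Real.exp (1 * y - 1 ^ 2 * w / 2) := by
        unfold mixDensity
        rw [add_mul, mul_assoc, ← Real.exp_add]
        ring_nf
      rw [this]; unfold mixDensity
      have : 1 ≤ Real.exp (2 * y) := Real.one_le_exp (by linarith)
      nlinarith
    refine h3.trans (mul_le_mul_of_nonneg_left ?_ (mixDensity_pos h0 h1 w 1 (-y)).le)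
    apply Real.exp_le_exp.2
    calc 2 * y ≤ 4 * γ * y * 1 := by nlinarith
      _ ≤ _ := by gcongr

/-- Symmetrization: for the density `p` at `y` and `q` at `-y`. -/
lemma rpow_symm_le {p q t l X : ℝ} (hq : 0 < q) (hqp : q ≤ p) (hpq : p ≤ q * Real.exp t)
    (hl : 0 ≤ l) (hX : Real.exp (l * t) ≤ X) :
    p * (p / q) ^ l + q * (q / p) ^ l ≤ p * X + q * X⁻¹ := by
  have hp : 0 < p := hq.trans_le hqp
  set E := (p / q) ^ l with hE
  have hE1 : 1 ≤ E := Real.one_le_rpow ((one_le_div hq).2 hqp) hl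
  have hEX : E ≤ X := by
    refine le_trans ?_ hX
    rw [mul_comm, Real.exp_mul]
    exact Real.rpow_le_rpow (by positivity) ((div_le_iff₀ hq).2 (by linarith)) hl
  have hinv : (q / p) ^ l = E⁻¹ := by
    rw [hE, ← Real.inv_rpow (by positivity), inv_div]
  rw [hinv]
  have hX0 : 0 < X := by linarith
  have hE0 : 0 < E := by linarith
  -- For `q ≤ p` the function `E ↦ pE + q/E` is nondecreasing on `E ≥ 1`, so the ratio may be
  -- replaced by an upper bound.
  have : E⁻¹ - X⁻¹ ≤ X - E := by
    rw [inv_sub_inv hE0.ne' hX0.ne']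
    rw [div_le_iff₀ (by positivity)]
    have : 1 ≤ E * X := by nlinarith
    nlinarith
  nlinarith [sub_nonneg.2 hEX]

/-! ### Gaussian integrals of the mixture density. -/

section Integrals

lemma lintegral_exp_gaussianReal (w : ℝ≥0) (s : ℝ) :
    ∫⁻ y, ENNReal.ofReal (Real.exp (s * y)) ∂gaussianReal 0 w
      = ENNReal.ofReal (Real.exp (w * s ^ 2 / 2)) := by
  rw [← ofReal_integral_eq_lintegral_ofReal (integrable_exp_mul_gaussianReal s)
    (Filter.Eventually.of_forall fun _ => (Real.exp_pos _).le)]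
  have := congrFun (mgf_id_gaussianReal (μ := 0) (v := w)) s
  simp only [mgf, id] at this
  rw [this]; simp

lemma lintegral_mixDensity_mul_exp (γ : ℝ) (h0 : 0 ≤ γ) (h1 : γ ≤ 1) (w : ℝ≥0) (t s : ℝ) :
    ∫⁻ y, ENNReal.ofReal (mixDensity γ w t y * Real.exp (s * y)) ∂gaussianReal 0 w
      = ENNReal.ofReal (Real.exp (w * s ^ 2 / 2) * (1 - γ + γ * Real.exp (t * s * w))) := by
  have h : ∀ y, ENNReal.ofReal (mixDensity γ w t y * Real.exp (s * y))
      = ENNReal.ofReal (1 - γ) * ENNReal.ofReal (Real.exp (s * y))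
        + ENNReal.ofReal (γ * Real.exp (- (t ^ 2 * w / 2)))
          * ENNReal.ofReal (Real.exp ((t + s) * y)) := by
    intro y
    rw [← ENNReal.ofReal_mul (by linarith), ← ENNReal.ofReal_mul (by positivity),
      ← ENNReal.ofReal_add (mul_nonneg (by linarith) (Real.exp_pos _).le) (by positivity)]
    congr 1
    unfold mixDensity
    rw [add_mul, mul_assoc, ← Real.exp_add, mul_assoc, ← Real.exp_add]
    ring_nf
  simp_rw [h]
  rw [lintegral_add_left (by fun_prop), lintegral_const_mul _ (by fun_prop),
    lintegral_const_mul _ (by fun_prop), lintegral_exp_gaussianReal, lintegral_exp_gaussianReal,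
    ← ENNReal.ofReal_mul (by linarith), ← ENNReal.ofReal_mul (by positivity),
    ← ENNReal.ofReal_add (mul_nonneg (by linarith) (Real.exp_pos _).le) (by positivity)]
  congr 1
  rw [mul_add, mul_assoc, ← Real.exp_add, mul_left_comm, ← Real.exp_add]
  ring_nf

lemma lintegral_mixDensity {γ : ℝ} (h0 : 0 ≤ γ) (h1 : γ ≤ 1) (w : ℝ≥0) (t : ℝ) :
    ∫⁻ y, ENNReal.ofReal (mixDensity γ w t y) ∂gaussianReal 0 w = 1 := by
  simpa using lintegral_mixDensity_mul_exp γ h0 h1 w t 0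

lemma lintegral_comp_neg_gaussianReal (w : ℝ≥0) (F : ℝ → ℝ≥0∞) :
    ∫⁻ y, F (-y) ∂gaussianReal 0 w = ∫⁻ y, F y ∂gaussianReal 0 w := by
  have h : (gaussianReal 0 w).map (MeasurableEquiv.neg ℝ) = gaussianReal 0 w := by
    have := gaussianReal_map_neg (μ := 0) (v := w)
    rw [neg_zero] at this
    exact this
  conv_rhs => rw [← h]
  rw [lintegral_map_equiv]; rfl

/-- Integrals over a symmetric interval are compared through symmetrized integrands. -/
lemma lintegral_le_of_symm_le (w : ℝ≥0) (R : ℝ) {F H : ℝ → ℝ≥0∞} (hF : Measurable F)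
    (hH : Measurable H)
    (h : ∀ y, 0 ≤ y → y ≤ R → F y + F (-y) ≤ H y + H (-y)) :
    ∫⁻ y in {y | |y| ≤ R}, F y ∂gaussianReal 0 w ≤ ∫⁻ y, H y ∂gaussianReal 0 w := by
  have hG : MeasurableSet {y : ℝ | |y| ≤ R} := measurableSet_le (by fun_prop) (by fun_prop)
  rw [← lintegral_indicator hG]
  set F' := Set.indicator {y : ℝ | |y| ≤ R} F with hF'
  have hm : Measurable F' := hF.indicator hG
  have key : ∀ K : ℝ → ℝ≥0∞, Measurable K →
      2 * ∫⁻ y, K y ∂gaussianReal 0 w = ∫⁻ y, K y + K (-y) ∂gaussianReal 0 w := by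
    intro K hK
    rw [lintegral_add_left hK, lintegral_comp_neg_gaussianReal w K, two_mul]
  have h2 : 2 * ∫⁻ y, F' y ∂gaussianReal 0 w ≤ 2 * ∫⁻ y, H y ∂gaussianReal 0 w := by
    rw [key _ hm, key _ hH]
    refine lintegral_mono fun y => ?_
    by_cases hy : |y| ≤ R
    · have e1 : F' y = F y := Set.indicator_of_mem (by exact hy) _
      have e2 : F' (-y) = F (-y) := Set.indicator_of_mem (by simpa using hy) _
      rw [e1, e2]
      rcases le_total 0 y with h0 | h0
      · exact h y h0 ((le_abs_self y).trans hy)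
      · have := h (-y) (by linarith) ((neg_le_abs y).trans hy)
        rw [neg_neg] at this
        rwa [add_comm, add_comm (H y)]
    · have e1 : F' y = 0 := Set.indicator_of_notMem (by exact hy) _
      have e2 : F' (-y) = 0 := Set.indicator_of_notMem (by simpa using hy) _
      rw [e1, e2]; simp
  exact (ENNReal.mul_le_mul_iff_right (by simp) (by simp)).1 h2

end Integrals

/-! ### Truncated moments and tails of the likelihood ratio. -/

lemma one_sub_add_mul_exp_le {γ a : ℝ} (h0 : 0 ≤ γ) (h1 : γ ≤ 1) (ha : 0 ≤ a) :
    1 - γ + γ * Real.exp a ≤ Real.exp (γ * a + a ^ 2) := by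
  rcases le_or_gt a 1 with h | h
  · have h2 : Real.exp a ≤ 1 + a + a ^ 2 := by
      have := Real.abs_exp_sub_one_sub_id_le (x := a) (by rwa [abs_of_nonneg ha])
      linarith [le_abs_self (Real.exp a - 1 - a)]
    have := Real.add_one_le_exp (γ * a + a ^ 2)
    nlinarith [sq_nonneg a]
  · have h2 : Real.exp a ≤ Real.exp (γ * a + a ^ 2) := by
      apply Real.exp_le_exp.2; nlinarith [mul_nonneg h0 ha]
    have : 1 ≤ Real.exp a := Real.one_le_exp ha
    nlinarith

/-- The truncated moments of the likelihood ratio, when the truncation level is constant. -/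
lemma lintegral_ratio_rpow_le_of_le_one {γ : ℝ} (h0 : 0 ≤ γ) (h1 : γ ≤ 1) {w : ℝ≥0} (hw : w ≤ 1)
    {l : ℝ} (hl : 0 ≤ l) :
    ∫⁻ y in {y | |y| ≤ 1}, ENNReal.ofReal (mixDensity γ w 1 y
        * (mixDensity γ w 1 y / mixDensity γ w (-1) y) ^ l) ∂gaussianReal 0 w
      ≤ ENNReal.ofReal (Real.exp (400 * w * γ ^ 2 * (l * (l + 1)))) := by
  have hw' : (w : ℝ) ≤ 1 := by exact_mod_cast hw
  -- On `0 ≤ y ≤ 1` one has `e^y ≤ 3`, so `l` times the loss is at most `12γl·y`. The comparison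
  -- integrand is a pure exponential tilt of the mixture, which integrates exactly.
  set α := 12 * γ * l with hα
  have hα0 : 0 ≤ α := by positivity
  have hpos := mixDensity_pos h0 h1 w
  have := lintegral_le_of_symm_le w 1 (F := fun y => ENNReal.ofReal (mixDensity γ w 1 y
        * (mixDensity γ w 1 y / mixDensity γ w (-1) y) ^ l))
      (H := fun y => ENNReal.ofReal (mixDensity γ w 1 y * Real.exp (α * y)))
      (by fun_prop) (by fun_prop) ?_
  · refine this.trans ?_
    rw [lintegral_mixDensity_mul_exp γ h0 h1]
    apply ENNReal.ofReal_le_ofReal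
    calc _ ≤ Real.exp (w * α ^ 2 / 2) * Real.exp (γ * (1 * α * w) + (1 * α * w) ^ 2) := by
          gcongr
          exact one_sub_add_mul_exp_le h0 h1 (by positivity)
      _ ≤ _ := by
          rw [← Real.exp_add]
          apply Real.exp_le_exp.2
          have e : w * α ^ 2 / 2 + (γ * (1 * α * w) + (1 * α * w) ^ 2)
              = (w * γ ^ 2) * (72 * l ^ 2 + 12 * l + 144 * w * l ^ 2) := by rw [hα]; ring
          have e' : 400 * w * γ ^ 2 * (l * (l + 1)) = (w * γ ^ 2) * (400 * (l * (l + 1))) := by ring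
          rw [e, e']
          refine mul_le_mul_of_nonneg_left ?_ (by positivity)
          nlinarith [sq_nonneg l, mul_nonneg (sq_nonneg l) (sub_nonneg.2 hw')]
  · intro y hy hy1
    have hX : Real.exp (l * (4 * γ * y * Real.exp y)) ≤ Real.exp (α * y) := by
      apply Real.exp_le_exp.2
      have : Real.exp y ≤ 3 :=
        (Real.exp_le_exp.2 hy1).trans Real.exp_one_lt_three.le
      calc l * (4 * γ * y * Real.exp y) ≤ l * (4 * γ * y * 3) := by gcongr
        _ = _ := by rw [hα]; ring
    have := rpow_symm_le (hpos 1 (-y)) (mixDensity_neg_le h0 hy w)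
      (mixDensity_le_exp_mul h0 h1 w.2 hy) hl hX
    rw [mixDensity_neg, mixDensity_neg, neg_neg]
    rw [← ENNReal.ofReal_add, ← ENNReal.ofReal_add]
    · apply ENNReal.ofReal_le_ofReal
      rw [mul_neg, Real.exp_neg]; exact this
    all_goals first
      | exact mul_nonneg (hpos _ _).le (Real.exp_pos _).le
      | exact mul_nonneg (hpos _ _).le (Real.rpow_nonneg (div_nonneg (hpos _ _).le (hpos _ _).le) _)

/-- Trades `y²` for a factor `w` and exponentials of rate `w^(-1/2)`, whose `N(0, w)`-integrals are
bounded independently of `w`. This is the source of the factor `w` in the moment bound. -/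
lemma sq_le_mul_exp_add_exp {w : ℝ} (hw : 0 < w) (y : ℝ) :
    y ^ 2 ≤ 2 * w * (Real.exp ((√w)⁻¹ * y) + Real.exp (-((√w)⁻¹ * y))) := by
  have key : ∀ x : ℝ, x ^ 2 ≤ 2 * (Real.exp x + Real.exp (-x)) := by
    intro x
    have h1 := Real.quadratic_le_exp_of_nonneg (abs_nonneg x)
    have h2 : Real.exp |x| ≤ Real.exp x + Real.exp (-x) := by
      rcases abs_choice x with h | h <;> rw [h] <;>
        linarith [Real.exp_pos x, Real.exp_pos (-x)]
    have h3 := abs_nonneg x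
    rw [sq_abs] at h1
    linarith
  have h := key ((√w)⁻¹ * y)
  have e : ((√w)⁻¹ * y) ^ 2 = w⁻¹ * y ^ 2 := by
    rw [mul_pow, inv_pow, Real.sq_sqrt hw.le]
  rw [e, inv_mul_le_iff₀ hw] at h
  linarith

/-- Second-order expansion of both exponentials. The linear terms combine to `(p - q) t`, a product
of two small quantities, and all remainders are `O(t²)` because `t ≤ B`. -/
lemma mul_exp_add_mul_exp_neg_le {p q t B : ℝ} (hq : 0 ≤ q) (hqp : q ≤ p) (ht : 0 ≤ t)
    (htB : t ≤ B) :
    p * Real.exp t + q * (Real.exp t)⁻¹ ≤ p + q + (p - q) * t + 2 * p * Real.exp B * t ^ 2 := by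
  have hB : 1 ≤ Real.exp B := Real.one_le_exp (ht.trans htB)
  have htB' : Real.exp t ≤ Real.exp B := Real.exp_le_exp.2 htB
  have h1 : Real.exp t - 1 ≤ t * Real.exp t := by
    have h := Real.add_one_le_exp (-t)
    rw [Real.exp_neg] at h
    have h' := mul_le_mul_of_nonneg_right h (Real.exp_pos t).le
    rw [inv_mul_cancel₀ (Real.exp_pos t).ne'] at h'
    linarith
  have h2 : Real.exp t - 1 - t ≤ t ^ 2 * Real.exp B := by
    have : Real.exp t - 1 - t ≤ t * (t * Real.exp t) := by
      have hb := Real.add_one_le_exp t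
      by_cases ht1 : t ≤ 1
      · nlinarith [mul_nonneg ht (Real.exp_pos t).le, Real.exp_bound' ht ht1 (n := 2) (by norm_num)]
      · nlinarith [mul_nonneg ht (Real.exp_pos t).le]
    nlinarith [sq_nonneg t]
  have h3 : (Real.exp t)⁻¹ - 1 + t ≤ t ^ 2 * Real.exp B := by
    have h4 : (Real.exp t)⁻¹ ≤ (1 + t)⁻¹ :=
      inv_anti₀ (by linarith) (by linarith [Real.add_one_le_exp t])
    have h5 : (1 + t)⁻¹ - 1 + t ≤ t ^ 2 := by
      have : (1 + t)⁻¹ - 1 + t = t ^ 2 / (1 + t) := by field_simp; ring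
      rw [this]; exact div_le_self (sq_nonneg t) (by linarith)
    nlinarith [sq_nonneg t]
  have hp : 0 ≤ p := hq.trans hqp
  have h6 := mul_le_mul_of_nonneg_left h2 hp
  have h7 := mul_le_mul_of_nonneg_left h3 hq
  have h8 : q * (t ^ 2 * Real.exp B) ≤ p * (t ^ 2 * Real.exp B) := by gcongr
  nlinarith

/-- The truncated moments of the likelihood ratio, when the truncated loss is bounded. -/
lemma lintegral_ratio_rpow_le_of_bounded {γ : ℝ} (h0 : 0 ≤ γ) (h1 : γ ≤ 1) {w : ℝ≥0}
    (hw0 : 0 < w) (hw : w ≤ 1) {l R B : ℝ} (hl : 0 ≤ l)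
    (hB : l * (4 * γ * R * Real.exp R) ≤ B) :
    ∫⁻ y in {y | |y| ≤ R}, ENNReal.ofReal (mixDensity γ w 1 y
        * (mixDensity γ w 1 y / mixDensity γ w (-1) y) ^ l) ∂gaussianReal 0 w
      ≤ ENNReal.ofReal (Real.exp (128 * Real.exp (8 + B) * w * γ ^ 2 * (l * (l + 1)))) := by
  have hw' : (w : ℝ) ≤ 1 := by exact_mod_cast hw
  have hw0' : (0 : ℝ) < w := by exact_mod_cast hw0
  have hpos := mixDensity_pos h0 h1 w
  set D := 32 * Real.exp B * γ ^ 2 * (l * (l + 1)) * w with hD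
  have hD0 : 0 ≤ D := by positivity
  set u := (√(w : ℝ))⁻¹ with hu
  have huw : w * u ^ 2 = 1 := by
    rw [hu, inv_pow, Real.sq_sqrt hw0'.le, mul_inv_cancel₀ hw0'.ne']
  have huw' : w * u ≤ 1 := by
    have : 1 ≤ u := by
      rw [hu]; exact (one_le_inv₀ (by positivity)).2 (Real.sqrt_le_one.2 hw')
    nlinarith
  have hsplit : ∀ y, (Real.exp (u * y) + Real.exp (-(u * y)))
        * (Real.exp (3 * y) + Real.exp (-(3 * y)))
      = Real.exp ((u + 3) * y) + Real.exp ((u - 3) * y) + Real.exp ((-u + 3) * y)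
        + Real.exp ((-u - 3) * y) := by
    intro y
    rw [add_mul, mul_add, mul_add, ← Real.exp_add, ← Real.exp_add, ← Real.exp_add,
      ← Real.exp_add]
    ring_nf
  set V : ℝ → ℝ := fun y => Real.exp ((u + 3) * y) + Real.exp ((u - 3) * y)
    + Real.exp ((-u + 3) * y) + Real.exp ((-u - 3) * y) with hV
  have hVneg : ∀ y, V (-y) = V y := by intro y; simp only [hV]; ring_nf
  have hV0 : ∀ y, 0 ≤ V y := fun y => by positivity
  have hVint : ∫⁻ y, ENNReal.ofReal (V y) ∂gaussianReal 0 w ≤ ENNReal.ofReal (4 * Real.exp 8) := by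
    have e : ∀ y, ENNReal.ofReal (V y) = ENNReal.ofReal (Real.exp ((u + 3) * y))
        + ENNReal.ofReal (Real.exp ((u - 3) * y)) + ENNReal.ofReal (Real.exp ((-u + 3) * y))
        + ENNReal.ofReal (Real.exp ((-u - 3) * y)) := by
      intro y
      rw [← ENNReal.ofReal_add, ← ENNReal.ofReal_add, ← ENNReal.ofReal_add] <;> positivity
    simp_rw [e]
    rw [lintegral_add_left (by fun_prop), lintegral_add_left (by fun_prop),
      lintegral_add_left (by fun_prop)]
    simp_rw [lintegral_exp_gaussianReal]
    rw [← ENNReal.ofReal_add, ← ENNReal.ofReal_add, ← ENNReal.ofReal_add]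
    · apply ENNReal.ofReal_le_ofReal
      have hu0 : 0 ≤ u := by positivity
      -- Since `w u² = 1`, `w u ≤ 1` and `w ≤ 1`, each rate `s = ±u ± 3` has `w s² ≤ 1 + 6 + 9 =
      -- 16`.
      have b : ∀ s : ℝ, w * s ^ 2 ≤ 16 → Real.exp (w * s ^ 2 / 2) ≤ Real.exp 8 := fun s hs =>
        Real.exp_le_exp.2 (by linarith)
      have wu : 0 ≤ w * u := by positivity
      have b1 := b (u + 3) (by nlinarith)
      have b2 := b (u - 3) (by nlinarith)
      have b3 := b (-u + 3) (by nlinarith)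
      have b4 := b (-u - 3) (by nlinarith)
      linarith
    all_goals positivity
  have := lintegral_le_of_symm_le w R (F := fun y => ENNReal.ofReal (mixDensity γ w 1 y
        * (mixDensity γ w 1 y / mixDensity γ w (-1) y) ^ l))
      (H := fun y => ENNReal.ofReal (mixDensity γ w 1 y) + ENNReal.ofReal D * ENNReal.ofReal (V y))
      (by fun_prop) (by fun_prop) ?_
  · refine this.trans ?_
    rw [lintegral_add_left (by fun_prop), lintegral_mixDensity h0 h1,
      lintegral_const_mul _ (by fun_prop)]
    calc _ ≤ 1 + ENNReal.ofReal D * ENNReal.ofReal (4 * Real.exp 8) := by gcongr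
      _ = ENNReal.ofReal (1 + D * (4 * Real.exp 8)) := by
          rw [← ENNReal.ofReal_mul hD0, ← ENNReal.ofReal_one, ← ENNReal.ofReal_add zero_le_one
            (by positivity)]
      _ ≤ _ := by
          apply ENNReal.ofReal_le_ofReal
          have := Real.add_one_le_exp (128 * Real.exp (8 + B) * w * γ ^ 2 * (l * (l + 1)))
          refine le_trans (le_of_eq ?_) this
          rw [hD, Real.exp_add]; ring
  · intro y hy hyR
    have ht0 : 0 ≤ l * (4 * γ * y * Real.exp y) := by positivity
    have htB : l * (4 * γ * y * Real.exp y) ≤ B := by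
      have hR0 : 0 ≤ R := hy.trans hyR
      refine le_trans ?_ hB
      gcongr
    have hle := mixDensity_neg_le h0 hy w
    have s1 := rpow_symm_le (hpos 1 (-y)) hle (mixDensity_le_exp_mul h0 h1 w.2 hy) hl le_rfl
    have s2 := mul_exp_add_mul_exp_neg_le (hpos 1 (-y)).le hle ht0 htB
    have s3 := mixDensity_sub_le h0 w.2 hy
    have s4 : mixDensity γ w 1 y ≤ Real.exp y := by
      unfold mixDensity
      have a1 : Real.exp (1 * y - 1 ^ 2 * w / 2) ≤ Real.exp y :=
        Real.exp_le_exp.2 (by linarith)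
      have a2 : 1 ≤ Real.exp y := Real.one_le_exp hy
      nlinarith
    have s5 : (mixDensity γ w 1 y - mixDensity γ w 1 (-y)) * (l * (4 * γ * y * Real.exp y))
        + 2 * mixDensity γ w 1 y * Real.exp B * (l * (4 * γ * y * Real.exp y)) ^ 2 ≤
        2 * (D * V y) := by
      have a2 : 1 ≤ Real.exp y := Real.one_le_exp hy
      have hB1 : 1 ≤ Real.exp B := Real.one_le_exp (ht0.trans htB)
      have a3 : y ^ 2 * Real.exp (3 * y) ≤ 2 * w * V y := by
        simp only [hV, ← hsplit]
        have c1 := sq_le_mul_exp_add_exp hw0' y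
        have c2 : Real.exp (3 * y) ≤ Real.exp (3 * y) + Real.exp (-(3 * y)) := by
          linarith [Real.exp_pos (-(3 * y))]
        rw [← mul_assoc]
        gcongr
      have e3 : Real.exp (3 * y) = Real.exp y ^ 3 := by rw [← Real.exp_nat_mul]; norm_num
      have E2 : Real.exp y ^ 2 ≤ Real.exp B * Real.exp (3 * y) := by
        rw [e3]; nlinarith [pow_pos (Real.exp_pos y) 2, pow_pos (Real.exp_pos y) 3]
      calc _ ≤ (γ * (2 * y * Real.exp y)) * (l * (4 * γ * y * Real.exp y))
            + 2 * Real.exp y * Real.exp B * (l * (4 * γ * y * Real.exp y)) ^ 2 := by gcongr; exact s3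
        _ = 8 * γ ^ 2 * l * y ^ 2 * Real.exp y ^ 2
            + 32 * γ ^ 2 * l ^ 2 * y ^ 2 * (Real.exp B * Real.exp (3 * y)) := by rw [e3]; ring
        _ ≤ 8 * γ ^ 2 * l * y ^ 2 * (Real.exp B * Real.exp (3 * y))
            + 32 * γ ^ 2 * l ^ 2 * y ^ 2 * (Real.exp B * Real.exp (3 * y)) := by gcongr
        _ ≤ 32 * γ ^ 2 * l * y ^ 2 * (Real.exp B * Real.exp (3 * y))
            + 32 * γ ^ 2 * l ^ 2 * y ^ 2 * (Real.exp B * Real.exp (3 * y)) := by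
            gcongr; norm_num
        _ = 32 * Real.exp B * γ ^ 2 * (l * (l + 1)) * (y ^ 2 * Real.exp (3 * y)) := by ring
        _ ≤ 32 * Real.exp B * γ ^ 2 * (l * (l + 1)) * (2 * w * V y) := by gcongr
        _ = _ := by rw [hD]; ring
    rw [mixDensity_neg, mixDensity_neg, neg_neg]
    have nn : ∀ a c, 0 ≤ mixDensity γ w 1 a * (mixDensity γ w 1 a / mixDensity γ w 1 c) ^ l :=
      fun a c => mul_nonneg (hpos _ _).le (Real.rpow_nonneg (div_nonneg (hpos _ _).le (hpos _ _).le) _)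
    rw [← ENNReal.ofReal_add (nn _ _) (nn _ _), ← ENNReal.ofReal_mul hD0, ← ENNReal.ofReal_mul hD0,
      ← ENNReal.ofReal_add (hpos _ _).le (mul_nonneg hD0 (hV0 _)),
      ← ENNReal.ofReal_add (hpos _ _).le (mul_nonneg hD0 (hV0 _)),
      ← ENNReal.ofReal_add (add_nonneg (hpos _ _).le (mul_nonneg hD0 (hV0 _)))
        (add_nonneg (hpos _ _).le (mul_nonneg hD0 (hV0 _)))]
    apply ENNReal.ofReal_le_ofReal
    rw [hVneg]
    linarith

lemma lintegral_mixDensity_tail_le {γ : ℝ} (h0 : 0 ≤ γ) (h1 : γ ≤ 1) {w : ℝ≥0} (hw0 : 0 < w)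
    {R : ℝ} (hR : 4 * w ≤ R) :
    ∫⁻ y in {y | |y| ≤ R}ᶜ, ENNReal.ofReal (mixDensity γ w 1 y) ∂gaussianReal 0 w
      ≤ ENNReal.ofReal (2 * Real.exp (-(R ^ 2 / (4 * w)))) := by
  have hw0' : (0 : ℝ) < w := by exact_mod_cast hw0
  have hpos := mixDensity_pos h0 h1 w 1
  have hG : MeasurableSet {y : ℝ | |y| ≤ R} := measurableSet_le (by fun_prop) (by fun_prop)
  -- Chernoff tilt. With `R = 2sw` the exponent `-sR + ws²/2 + sw` is `-(3/2)s²w + sw`; the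
  -- hypothesis `4w ≤ R` means `s ≥ 2`, so it is at most `-s²w = -R²/(4w)`.
  set s := R / (2 * w) with hs
  have hR0 : 0 < R := by linarith
  have hs0 : 0 < s := by positivity
  calc ∫⁻ y in {y | |y| ≤ R}ᶜ, ENNReal.ofReal (mixDensity γ w 1 y) ∂gaussianReal 0 w
      ≤ ∫⁻ y, ENNReal.ofReal (Real.exp (-(s * R)))
          * (ENNReal.ofReal (mixDensity γ w 1 y * Real.exp (s * y))
            + ENNReal.ofReal (mixDensity γ w 1 y * Real.exp (-s * y))) ∂gaussianReal 0 w := by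
        rw [← lintegral_indicator hG.compl]
        refine lintegral_mono fun y => ?_
        by_cases hy : y ∈ {y : ℝ | |y| ≤ R}ᶜ
        · rw [Set.indicator_of_mem hy]
          have hy' : R < |y| := not_le.1 hy
          have nn : ∀ x, 0 ≤ mixDensity γ w 1 y * Real.exp x := fun x =>
            mul_nonneg (hpos y).le (Real.exp_pos x).le
          rw [← ENNReal.ofReal_add (nn _) (nn _), ← ENNReal.ofReal_mul (Real.exp_pos _).le]
          apply ENNReal.ofReal_le_ofReal
          rw [← mul_add, mul_left_comm]
          refine le_mul_of_one_le_right (hpos y).le ?_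
          rw [mul_add, ← Real.exp_add, ← Real.exp_add]
          rcases abs_choice y with h | h
          · have : 1 ≤ Real.exp (-(s * R) + s * y) := Real.one_le_exp (by nlinarith)
            linarith [Real.exp_pos (-(s * R) + -s * y)]
          · have : 1 ≤ Real.exp (-(s * R) + -s * y) := Real.one_le_exp (by nlinarith)
            linarith [Real.exp_pos (-(s * R) + s * y)]
        · rw [Set.indicator_of_notMem hy]; exact zero_le
    _ = ENNReal.ofReal (Real.exp (-(s * R))) *
        (ENNReal.ofReal (Real.exp (w * s ^ 2 / 2) * (1 - γ + γ * Real.exp (1 * s * w)))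
         + ENNReal.ofReal (Real.exp (w * (-s) ^ 2 / 2) * (1 - γ + γ * Real.exp (1 * (-s) * w)))) := by
        rw [lintegral_const_mul _ (by fun_prop), lintegral_add_left (by fun_prop),
          lintegral_mixDensity_mul_exp γ h0 h1, lintegral_mixDensity_mul_exp γ h0 h1]
    _ ≤ ENNReal.ofReal (Real.exp (-(s * R))) *
        (ENNReal.ofReal (Real.exp (w * s ^ 2 / 2) * Real.exp (s * w))
         + ENNReal.ofReal (Real.exp (w * s ^ 2 / 2) * Real.exp (s * w))) := by
        have a0 : 1 ≤ Real.exp (s * w) := Real.one_le_exp (by positivity)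
        have a1 : 1 - γ + γ * Real.exp (1 * s * w) ≤ Real.exp (s * w) := by
          rw [one_mul]; nlinarith
        have a2 : 1 - γ + γ * Real.exp (1 * (-s) * w) ≤ Real.exp (s * w) := by
          have : Real.exp (1 * (-s) * w) ≤ 1 := Real.exp_le_one_iff.2 (by nlinarith)
          nlinarith
        rw [neg_sq]
        gcongr
    _ ≤ _ := by
        rw [← ENNReal.ofReal_add (by positivity) (by positivity),
          ← ENNReal.ofReal_mul (by positivity)]
        apply ENNReal.ofReal_le_ofReal
        rw [← two_mul, mul_left_comm, ← Real.exp_add, ← Real.exp_add]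
        gcongr
        have e : R = s * (2 * w) := by rw [hs]; field_simp
        have e2 : R ^ 2 / (4 * w) = s ^ 2 * w := by rw [e]; field_simp; ring
        rw [e2, e]
        have : 2 ≤ s := by rw [hs, le_div_iff₀ (by positivity)]; linarith
        nlinarith [mul_pos hs0 hw0']

/-! ### Composition over independent coordinates. -/

section Product

variable {ι : Type*} [Fintype ι]

lemma lintegral_pi_prod {X : ι → Type*} [∀ i, MeasurableSpace (X i)] (μ : ∀ i, Measure (X i))
    [∀ i, IsProbabilityMeasure (μ i)] {f : ∀ i, X i → ℝ≥0∞} (hf : ∀ i, Measurable (f i)) :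
    ∫⁻ x, ∏ i, f i (x i) ∂Measure.pi μ = ∏ i, ∫⁻ x, f i x ∂μ i := by
  have h := lintegral_prod_eq_prod_lintegral_of_indepFun Finset.univ
    (fun i (x : ∀ i, X i) => f i (x i)) (iIndepFun_pi (μ := μ) fun i => (hf i).aemeasurable)
    (fun i => (hf i).comp (measurable_pi_apply i))
  rw [h]
  refine Finset.prod_congr rfl fun i _ => ?_
  exact (measurePreserving_eval μ i).lintegral_comp (hf i)

lemma pi_withDensity_eq {X : ι → Type*} [∀ i, MeasurableSpace (X i)] (μ : ∀ i, Measure (X i))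
    [∀ i, IsProbabilityMeasure (μ i)] {f : ∀ i, X i → ℝ≥0∞} (hf : ∀ i, Measurable (f i))
    [∀ i, IsProbabilityMeasure ((μ i).withDensity (f i))] :
    Measure.pi (fun i => (μ i).withDensity (f i))
      = (Measure.pi μ).withDensity (fun x => ∏ i, f i (x i)) := by
  refine (Measure.pi_eq fun s hs => ?_)
  rw [withDensity_apply _ (MeasurableSet.univ_pi hs), ← lintegral_indicator
    (MeasurableSet.univ_pi hs)]
  have : ∀ x : ∀ i, X i, (Set.univ.pi s).indicator (fun x => ∏ i, f i (x i)) x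
      = ∏ i, (s i).indicator (f i) (x i) := by
    intro x
    by_cases hx : x ∈ Set.univ.pi s
    · rw [Set.indicator_of_mem hx]
      refine Finset.prod_congr rfl fun i _ => ?_
      rw [Set.indicator_of_mem (hx i trivial)]
    · rw [Set.indicator_of_notMem hx]
      simp only [Set.mem_pi, Set.mem_univ, true_implies, not_forall] at hx
      obtain ⟨i, hi⟩ := hx
      exact (Finset.prod_eq_zero (Finset.mem_univ i) (Set.indicator_of_notMem hi _)).symm
  simp_rw [this]
  rw [lintegral_pi_prod μ fun i => (hf i).indicator (hs i)]
  refine Finset.prod_congr rfl fun i _ => ?_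
  rw [lintegral_indicator (hs i), withDensity_apply _ (hs i)]

/-- Approximate differential privacy of a product of mechanisms, from truncated moments of the
likelihood ratios of its factors. -/
lemma pi_withDensity_le (μ : Measure ℝ) [IsProbabilityMeasure μ] (f g : ι → ℝ → ℝ)
    (hf : ∀ i, Measurable (f i)) (hg : ∀ i, Measurable (g i))
    (hf0 : ∀ i y, 0 < f i y) (hg0 : ∀ i y, 0 < g i y)
    (hf1 : ∀ i, ∫⁻ y, ENNReal.ofReal (f i y) ∂μ = 1)
    (hg1 : ∀ i, ∫⁻ y, ENNReal.ofReal (g i y) ∂μ = 1)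
    (G : ι → Set ℝ) (hG : ∀ i, MeasurableSet (G i)) {l ε : ℝ} (hl : 0 ≤ l) (η κ : ι → ℝ)
    (hη0 : ∀ i, 0 ≤ η i)
    (hη : ∀ i, ∫⁻ y in (G i)ᶜ, ENNReal.ofReal (f i y) ∂μ ≤ ENNReal.ofReal (η i))
    (hκ : ∀ i, ∫⁻ y in G i, ENNReal.ofReal (f i y * (f i y / g i y) ^ l) ∂μ
      ≤ ENNReal.ofReal (Real.exp (κ i)))
    {S : Set (ι → ℝ)} (hS : MeasurableSet S) :
    Measure.pi (fun i => μ.withDensity fun y => ENNReal.ofReal (f i y)) S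
      ≤ ENNReal.ofReal (Real.exp ε)
          * Measure.pi (fun i => μ.withDensity fun y => ENNReal.ofReal (g i y)) S
        + ENNReal.ofReal (∑ i, η i + Real.exp (-(l * ε) + ∑ i, κ i)) := by
  have pf : ∀ i, IsProbabilityMeasure (μ.withDensity fun y => ENNReal.ofReal (f i y)) := fun i =>
    ⟨by rw [withDensity_apply _ .univ, setLIntegral_univ, hf1]⟩
  have pg : ∀ i, IsProbabilityMeasure (μ.withDensity fun y => ENNReal.ofReal (g i y)) := fun i =>
    ⟨by rw [withDensity_apply _ .univ, setLIntegral_univ, hg1]⟩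
  set F : (ι → ℝ) → ℝ := fun x => ∏ i, f i (x i) with hF
  set H : (ι → ℝ) → ℝ := fun x => ∏ i, g i (x i) with hH
  have hF0 : ∀ x, 0 < F x := fun x => Finset.prod_pos fun i _ => hf0 i _
  have hH0 : ∀ x, 0 < H x := fun x => Finset.prod_pos fun i _ => hg0 i _
  have hFm : Measurable F := by fun_prop
  have hHm : Measurable H := by fun_prop
  have eP : Measure.pi (fun i => μ.withDensity fun y => ENNReal.ofReal (f i y))
      = (Measure.pi fun _ => μ).withDensity fun x => ENNReal.ofReal (F x) := by
    rw [pi_withDensity_eq (fun _ => μ) fun i => by fun_prop]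
    congr 1; ext x
    rw [ENNReal.ofReal_prod_of_nonneg fun i _ => (hf0 i _).le]
  have eQ : Measure.pi (fun i => μ.withDensity fun y => ENNReal.ofReal (g i y))
      = (Measure.pi fun _ => μ).withDensity fun x => ENNReal.ofReal (H x) := by
    rw [pi_withDensity_eq (fun _ => μ) fun i => by fun_prop]
    congr 1; ext x
    rw [ENNReal.ofReal_prod_of_nonneg fun i _ => (hg0 i _).le]
  set P := Measure.pi (fun i => μ.withDensity fun y => ENNReal.ofReal (f i y)) with hP
  set Q := Measure.pi (fun i => μ.withDensity fun y => ENNReal.ofReal (g i y)) with hQ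
  set T : Set (ι → ℝ) := {x | F x ≤ Real.exp ε * H x} with hT
  have hTm : MeasurableSet T := measurableSet_le hFm (by fun_prop)
  -- Either some coordinate is truncated, or the total loss is at most `ε`, or it exceeds `ε` with
  -- every coordinate inside its truncation set.
  have hcover : S ⊆ (⋃ i, {x | x i ∈ (G i)ᶜ}) ∪ ((S ∩ T) ∪ (Set.univ.pi G ∩ Tᶜ)) := by
    intro x hx
    by_cases h1 : x ∈ Set.univ.pi G
    · by_cases h2 : x ∈ T
      · exact Or.inr (Or.inl ⟨hx, h2⟩)
      · exact Or.inr (Or.inr ⟨h1, h2⟩)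
    · simp only [Set.mem_pi, Set.mem_univ, true_implies, not_forall] at h1
      obtain ⟨i, hi⟩ := h1
      exact Or.inl (Set.mem_iUnion.2 ⟨i, hi⟩)
  have b1 : P (⋃ i, {x | x i ∈ (G i)ᶜ}) ≤ ENNReal.ofReal (∑ i, η i) := by
    refine (measure_iUnion_fintype_le _ _).trans ?_
    rw [ENNReal.ofReal_sum_of_nonneg fun i _ => hη0 i]
    refine Finset.sum_le_sum fun i _ => ?_
    have := (measurePreserving_eval (fun i => μ.withDensity fun y => ENNReal.ofReal (f i y))
      i).measure_preimage (hG i).compl.nullMeasurableSet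
    rw [withDensity_apply _ (hG i).compl] at this
    exact this.le.trans (hη i)
  have b2 : P (S ∩ T) ≤ ENNReal.ofReal (Real.exp ε) * Q S := by
    rw [eP, eQ, withDensity_apply _ (hS.inter hTm), withDensity_apply _ hS,
      ← lintegral_const_mul _ (by fun_prop)]
    calc _ ≤ ∫⁻ x in S ∩ T, ENNReal.ofReal (Real.exp ε) * ENNReal.ofReal (H x)
            ∂Measure.pi fun _ => μ := by
          refine setLIntegral_mono' (hS.inter hTm) fun x hx => ?_
          rw [← ENNReal.ofReal_mul (Real.exp_pos _).le]
          exact ENNReal.ofReal_le_ofReal hx.2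
      _ ≤ _ := lintegral_mono_set Set.inter_subset_left
  have b3 : P (Set.univ.pi G ∩ Tᶜ) ≤ ENNReal.ofReal (Real.exp (-(l * ε) + ∑ i, κ i)) := by
    have hGm : MeasurableSet (Set.univ.pi G) := MeasurableSet.univ_pi hG
    rw [eP, withDensity_apply _ (hGm.inter hTm.compl), ← lintegral_indicator
      (hGm.inter hTm.compl)]
    -- Markov's inequality of order `l`: off `T` the ratio exceeds `e^ε`, so `1 ≤ e^(-lε) (F/H)^l`,
    -- and the right side factorizes over coordinates.
    have pt : ∀ x, (Set.univ.pi G ∩ Tᶜ).indicator (fun x => ENNReal.ofReal (F x)) x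
        ≤ ENNReal.ofReal (Real.exp (-(l * ε))) * ∏ i, (G i).indicator
          (fun y => ENNReal.ofReal (f i y * (f i y / g i y) ^ l)) (x i) := by
      intro x
      by_cases hx : x ∈ Set.univ.pi G ∩ Tᶜ
      · rw [Set.indicator_of_mem hx]
        have e : ∏ i, (G i).indicator
            (fun y => ENNReal.ofReal (f i y * (f i y / g i y) ^ l)) (x i)
            = ENNReal.ofReal (F x * (F x / H x) ^ l) := by
          rw [hF, hH]
          simp only
          rw [← Finset.prod_div_distrib, ← Real.finsetProd_rpow _ _
            fun i _ => (div_pos (hf0 i _) (hg0 i _)).le, ← Finset.prod_mul_distrib,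
            ENNReal.ofReal_prod_of_nonneg fun i _ => mul_nonneg (hf0 i _).le
              (Real.rpow_nonneg (div_pos (hf0 i _) (hg0 i _)).le _)]
          refine Finset.prod_congr rfl fun i _ => ?_
          rw [Set.indicator_of_mem (hx.1 i trivial)]
        rw [e, ← ENNReal.ofReal_mul (Real.exp_pos _).le]
        apply ENNReal.ofReal_le_ofReal
        rw [mul_left_comm]
        refine le_mul_of_one_le_right (hF0 x).le ?_
        have h2 : Real.exp ε * H x < F x := not_le.1 hx.2
        have h3 : Real.exp ε ≤ F x / H x := (le_div_iff₀ (hH0 x)).2 h2.le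
        have h4 : Real.exp (l * ε) ≤ (F x / H x) ^ l := by
          rw [mul_comm, Real.exp_mul]
          exact Real.rpow_le_rpow (Real.exp_pos _).le h3 hl
        rw [Real.exp_neg]
        rw [← div_eq_inv_mul, one_le_div (Real.exp_pos _)]
        exact h4
      · rw [Set.indicator_of_notMem hx]; exact zero_le
    refine (lintegral_mono pt).trans ?_
    have hm : ∀ i, Measurable ((G i).indicator
        (fun y => ENNReal.ofReal (f i y * (f i y / g i y) ^ l))) := fun i =>
      Measurable.indicator (by fun_prop) (hG i)
    have hm' : Measurable fun x : ι → ℝ => ∏ i, (G i).indicator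
        (fun y => ENNReal.ofReal (f i y * (f i y / g i y) ^ l)) (x i) :=
      Finset.measurable_prod _ fun i _ => (hm i).comp (measurable_pi_apply i)
    rw [lintegral_const_mul _ hm', lintegral_pi_prod _ hm,
      Real.exp_add, ENNReal.ofReal_mul (Real.exp_pos _).le, Real.exp_sum,
      ENNReal.ofReal_prod_of_nonneg fun i _ => (Real.exp_pos _).le]
    gcongr with i
    rw [lintegral_indicator (hG i)]
    exact hκ i
  calc P S ≤ P (⋃ i, {x | x i ∈ (G i)ᶜ}) + (P (S ∩ T) + P (Set.univ.pi G ∩ Tᶜ)) :=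
        (measure_mono hcover).trans ((measure_union_le _ _).trans
          (by gcongr; exact measure_union_le _ _))
    _ ≤ ENNReal.ofReal (∑ i, η i) + (ENNReal.ofReal (Real.exp ε) * Q S
          + ENNReal.ofReal (Real.exp (-(l * ε) + ∑ i, κ i))) := by gcongr
    _ = _ := by
        rw [ENNReal.ofReal_add (Finset.sum_nonneg fun i _ => hη0 i) (Real.exp_pos _).le]
        ring

end Product

/-- The product over the coordinates of the mixtures with shifts `t i ∈ {-1, 1}` for `i ∈ J`. -/
lemma pi_mixture_le {ι : Type*} [Fintype ι] {γ : ℝ} (h0 : 0 ≤ γ) (h1 : γ ≤ 1) (w : ℝ≥0)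
    {R l ε η κ : ℝ} (hl : 0 ≤ l) (hη0 : 0 ≤ η)
    (hη : ∫⁻ y in {y | |y| ≤ R}ᶜ, ENNReal.ofReal (mixDensity γ w 1 y) ∂gaussianReal 0 w
      ≤ ENNReal.ofReal η) (hκ0 : 0 ≤ κ)
    (hκ : ∫⁻ y in {y | |y| ≤ R}, ENNReal.ofReal (mixDensity γ w 1 y
        * (mixDensity γ w 1 y / mixDensity γ w (-1) y) ^ l) ∂gaussianReal 0 w
      ≤ ENNReal.ofReal (Real.exp κ))
    (J : Finset ι) (t t' : ι → ℝ) (ht : ∀ i ∈ J, t i = 1 ∨ t i = -1)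
    (ht' : ∀ i ∈ J, t' i = 1 ∨ t' i = -1) (htJ : ∀ i ∉ J, t i = 0) (htJ' : ∀ i ∉ J, t' i = 0)
    {S : Set (ι → ℝ)} (hS : MeasurableSet S) :
    Measure.pi (fun i => (gaussianReal 0 w).withDensity
        fun y => ENNReal.ofReal (mixDensity γ w (t i) y)) S
      ≤ ENNReal.ofReal (Real.exp ε)
          * Measure.pi (fun i => (gaussianReal 0 w).withDensity
            fun y => ENNReal.ofReal (mixDensity γ w (t' i) y)) S
        + ENNReal.ofReal (J.card * η + Real.exp (-(l * ε) + J.card * κ)) := by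
  classical
  have hG : MeasurableSet {y : ℝ | |y| ≤ R} := measurableSet_le (by fun_prop) (by fun_prop)
  have hpos := mixDensity_pos h0 h1 w
  have hflip : ∀ (A : Set ℝ) (hA : MeasurableSet A) (hsym : ∀ y, -y ∈ A ↔ y ∈ A) (F : ℝ → ℝ≥0∞),
      ∫⁻ y in A, F (-y) ∂gaussianReal 0 w = ∫⁻ y in A, F y ∂gaussianReal 0 w := by
    intro A hA hsym F
    rw [← lintegral_indicator hA, ← lintegral_indicator hA,
      ← lintegral_comp_neg_gaussianReal w (A.indicator F)]
    refine lintegral_congr fun y => ?_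
    by_cases hy : y ∈ A
    · rw [Set.indicator_of_mem hy, Set.indicator_of_mem ((hsym y).2 hy)]
    · rw [Set.indicator_of_notMem hy, Set.indicator_of_notMem (fun h => hy ((hsym y).1 h))]
  have hself : ∀ t : ℝ, ∫⁻ y in {y | |y| ≤ R}, ENNReal.ofReal (mixDensity γ w t y
        * (mixDensity γ w t y / mixDensity γ w t y) ^ l) ∂gaussianReal 0 w ≤ 1 := by
    intro t
    rw [← lintegral_mixDensity h0 h1 w t]
    refine (setLIntegral_le_lintegral _ _).trans_eq (lintegral_congr fun y => ?_)
    rw [div_self (hpos t y).ne', Real.one_rpow, mul_one]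
  have hexpκ : (1 : ℝ≥0∞) ≤ ENNReal.ofReal (Real.exp κ) := by
    rw [← ENNReal.ofReal_one]; exact ENNReal.ofReal_le_ofReal (Real.one_le_exp hκ0)
  have main := pi_withDensity_le (gaussianReal 0 w) (fun i => mixDensity γ w (t i))
    (fun i => mixDensity γ w (t' i)) (fun i => by fun_prop) (fun i => by fun_prop)
    (fun i => hpos _) (fun i => hpos _) (fun i => lintegral_mixDensity h0 h1 w _)
    (fun i => lintegral_mixDensity h0 h1 w _)
    -- Outside `J` both densities are `1`, so no truncation is needed and only `J.card` coordinates
    -- are charged.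
    (fun i => if i ∈ J then {y | |y| ≤ R} else Set.univ)
    (fun i => by split_ifs; exacts [hG, .univ]) hl (ε := ε)
    (fun i => if i ∈ J then η else 0) (fun i => if i ∈ J then κ else 0)
    (fun i => by split_ifs; exacts [hη0, le_rfl]) ?_ ?_ hS
  · simpa [Finset.sum_ite_mem] using main
  · intro i
    by_cases hi : i ∈ J
    · simp only [hi, if_true]
      rcases ht i hi with h | h
      · rw [h]; exact hη
      · rw [h]
        simp_rw [mixDensity_neg]
        rw [hflip _ hG.compl (by simp) fun y => ENNReal.ofReal (mixDensity γ w 1 y)]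
        exact hη
    · simp [hi]
  · intro i
    by_cases hi : i ∈ J
    · simp only [hi, if_true]
      rcases ht i hi with h | h <;> rcases ht' i hi with h' | h' <;> rw [h, h']
      · exact (hself 1).trans hexpκ
      · exact hκ
      -- The flip from `-1` to `1` is the reflection `y ↦ -y` of the flip from `1` to `-1`.
      · refine le_trans (le_of_eq ?_) hκ
        rw [← hflip _ hG (by simp)]
        simp_rw [mixDensity_neg, neg_neg]
      · exact (hself (-1)).trans hexpκ
    · simp [hi, htJ i hi, htJ' i hi, mixDensity_zero]

/-! ### Noise level, moment order and truncation level. -/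

/-- The noise level, relative to the sensitivity of a coordinate. Here `Λ = log (k / δ)`,
`L = log (1 / δ)` and `g = γ² k / ε²`. -/
noncomputable def noiseScale (A L Λ g ε : ℝ) : ℝ :=
  A * (min Λ (L + g * Λ * (Λ + ε)) + g * Λ * (L + ε))

lemma add_one_le_mul {l0 L : ℝ} (hl0 : 0 < l0) (hL : l0 ≤ L) : L + 1 ≤ (1 + 1 / l0) * L := by
  have : 1 ≤ 1 / l0 * L := by rw [one_div, ← div_eq_inv_mul]; exact (one_le_div hl0).2 hL
  linarith

/-- With `l = 2(L+1)/ε`, the product `l(l+1)` is `2(L+1)(2(L+1)+ε)/ε²`. One factor `L+1` is kept;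
the other is `O(L+ε)` because `L` is bounded below by `l0`, and it cancels against the bound on `q`,
which stands for `k w γ²`. -/
lemma loss_exponent_le {l0 A K L Λ ε q : ℝ} (hl0 : 0 < l0) (hL : l0 ≤ L) (hLΛ : L ≤ Λ)
    (hε : 0 < ε) (hK : 0 ≤ K) (hA0 : 0 < A) (hA : 4 * K * (1 + 1 / l0) ≤ A * l0)
    (hq : q * (A * Λ * (L + ε)) ≤ ε ^ 2) :
    K * q * (2 * (L + 1) / ε * (2 * (L + 1) / ε + 1)) ≤ L + 1 := by
  have hLp : 0 < L := hl0.trans_le hL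
  have hΛ : 0 < Λ := hLp.trans_le hLΛ
  have hM := add_one_le_mul hl0 hL
  have hM1 : 1 ≤ 1 + 1 / l0 := by have : 0 < 1 / l0 := by positivity
                                  linarith
  have hD : 0 < A * Λ * (L + ε) := by positivity
  have hq' : q ≤ ε ^ 2 / (A * Λ * (L + ε)) := (le_div_iff₀ hD).2 hq
  calc K * q * (2 * (L + 1) / ε * (2 * (L + 1) / ε + 1))
      ≤ K * (ε ^ 2 / (A * Λ * (L + ε))) * (2 * (L + 1) / ε * (2 * (L + 1) / ε + 1)) := by gcongr
    _ = (L + 1) * (2 * K * (2 * (L + 1) + ε) / (A * Λ * (L + ε))) := by field_simp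
    _ ≤ (L + 1) * 1 := by
        gcongr
        rw [div_le_one hD]
        calc 2 * K * (2 * (L + 1) + ε)
            ≤ 2 * K * (2 * ((1 + 1 / l0) * L) + 2 * ((1 + 1 / l0) * ε)) := by
              gcongr; nlinarith
          _ = 4 * K * (1 + 1 / l0) * (L + ε) := by ring
          _ ≤ A * l0 * (L + ε) := by gcongr
          _ ≤ A * Λ * (L + ε) := by gcongr; linarith
    _ = _ := mul_one _

/-- With `x = k^(1/4)`, the truncated loss is at most `4γx`. Here `γ²k·4Λ ≤ ε²` and `L+1 ≤ MΛ/4`, so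
the square of `l·4γx` is at most `M²Λ/x²`. This is bounded since `x² = √k` dominates `log k`, which
is comparable to `Λ`. -/
lemma truncated_loss_le {k γ ε M Λ L : ℝ} (hk0 : 0 < k) (hγ0 : 0 ≤ γ) (hε : 0 < ε) (hM1 : 1 < M)
    (hΛp : 0 < Λ) (hLp : 0 < L) (hML : L + 1 ≤ M * L) (hL4 : L < Λ / 4)
    (hg : 4 * (γ ^ 2 * k / ε ^ 2) * (Λ + ε) < 1) (hlogk : 3 / 4 * Λ < Real.log k) :
    2 * (L + 1) / ε * (4 * γ * (Real.log k / 8) * Real.exp (Real.log k / 8)) ≤ 2 * M := by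
  set R := Real.log k / 8 with hR
  set l := 2 * (L + 1) / ε with hl
  have hl0 : 0 ≤ l := by positivity
  set x := Real.exp (2 * R) with hx
  have hx0 : 0 < x := Real.exp_pos _
  have hx4 : x ^ 4 = k := by
    rw [hx, ← Real.exp_nat_mul, hR]
    conv_rhs => rw [← Real.exp_log hk0]
    congr 1; push_cast; ring
  have hx2 : 3 / 8 * Λ ≤ x ^ 2 := by
    have : x ^ 2 = Real.exp (4 * R) := by
      rw [hx, ← Real.exp_nat_mul]; congr 1; push_cast; ring
    rw [this]
    have := Real.add_one_le_exp (4 * R)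
    rw [hR] at this ⊢; linarith
  have hRx : R * Real.exp R ≤ x := by
    have e : x = Real.exp R * Real.exp R := by rw [hx, ← Real.exp_add]; ring_nf
    rw [e]
    gcongr
    linarith [Real.add_one_le_exp R]
  have hγε : γ ^ 2 * x ^ 4 * (4 * Λ) ≤ ε ^ 2 := by
    rw [hx4]
    have : γ ^ 2 * k / ε ^ 2 * (4 * Λ) ≤ 1 := by
      have : 0 ≤ γ ^ 2 * k / ε ^ 2 * ε := by positivity
      nlinarith
    rw [div_mul_eq_mul_div, div_le_one (by positivity)] at this
    exact this
  have hsq : (l * (4 * γ * x)) ^ 2 ≤ (2 * M) ^ 2 := by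
    have e : (l * (4 * γ * x)) ^ 2 = 64 * (L + 1) ^ 2 * γ ^ 2 * x ^ 2 / ε ^ 2 := by
      rw [hl]; field_simp; ring
    rw [e, div_le_iff₀ (by positivity)]
    have h1 : (L + 1) ^ 2 ≤ (M * (Λ / 4)) ^ 2 := by
      have : L + 1 ≤ M * (Λ / 4) := hML.trans (by gcongr)
      gcongr
    have h2 : Λ ≤ 8 / 3 * x ^ 2 := by linarith
    calc 64 * (L + 1) ^ 2 * γ ^ 2 * x ^ 2
        ≤ 64 * (M * (Λ / 4)) ^ 2 * γ ^ 2 * x ^ 2 := by gcongr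
      _ = M ^ 2 * (γ ^ 2 * x ^ 2 * (4 * Λ)) * Λ := by ring
      _ ≤ M ^ 2 * (γ ^ 2 * x ^ 2 * (4 * Λ)) * (8 / 3 * x ^ 2) := by gcongr
      _ = M ^ 2 * (8 / 3) * (γ ^ 2 * x ^ 4 * (4 * Λ)) := by ring
      _ ≤ M ^ 2 * (8 / 3) * ε ^ 2 := by gcongr
      _ ≤ (2 * M) ^ 2 * ε ^ 2 := by nlinarith [mul_pos (pow_pos (zero_lt_one.trans hM1) 2) (pow_pos hε 2)]
  calc l * (4 * γ * R * Real.exp R) = l * (4 * γ * (R * Real.exp R)) := by ring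
    _ ≤ l * (4 * γ * x) := by gcongr
    _ ≤ 2 * M := le_of_sq_le_sq hsq (by linarith)

set_option maxHeartbeats 1000000 in
/-- The truncation level and the moment for which the product of `k` coordinates is private. -/
lemma exists_truncation {l0 : ℝ} (hl0 : 0 < l0) :
    ∃ A : ℝ, 0 < A ∧ ∀ (k : ℕ) (γ ε δ : ℝ) (w : ℝ≥0), 1 ≤ k → 0 < γ → γ ≤ 1 → 0 < ε → 0 < δ →
      l0 ≤ Real.log (1 / δ) →
      (w : ℝ) * noiseScale A (Real.log (1 / δ)) (Real.log (k / δ)) (γ ^ 2 * k / ε ^ 2) ε = 1 →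
      ∃ R l η κ : ℝ, 0 ≤ l ∧ 0 ≤ η ∧ 0 ≤ κ ∧
        (∫⁻ y in {y | |y| ≤ R}ᶜ, ENNReal.ofReal (mixDensity γ w 1 y) ∂gaussianReal 0 w
          ≤ ENNReal.ofReal η) ∧
        (∫⁻ y in {y | |y| ≤ R}, ENNReal.ofReal (mixDensity γ w 1 y
          * (mixDensity γ w 1 y / mixDensity γ w (-1) y) ^ l) ∂gaussianReal 0 w
          ≤ ENNReal.ofReal (Real.exp κ)) ∧
        k * η + Real.exp (-(l * ε) + k * κ) ≤ δ := by
  set M := 1 + 1 / l0 with hM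
  have hM1 : 1 < M := by rw [hM]; linarith [show 0 < 1 / l0 by positivity]
  have hMl : M * l0 = l0 + 1 := by rw [hM]; field_simp
  -- `K` dominates the constants of both moment bounds, the second one taken with `B = 2M`.
  set K := 128 * Real.exp (8 + 2 * M) with hK
  have hK400 : 400 ≤ K := by
    have := Real.add_one_le_exp (8 + 2 * M); rw [hK]; linarith
  -- The term `4KM` serves the moment exponent, `4000` forces the noise scale `T ≥ 4000`, and `48M`
  -- serves the tail at `R = 1`.
  set A := (4 * K * M + 4000) / l0 + 48 * M with hA
  have hAl : 4 * K * M + 4000 ≤ A * l0 := by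
    have : A * l0 = 4 * K * M + 4000 + 48 * M * l0 := by rw [hA]; field_simp
    rw [this]; nlinarith
  have hA0 : 0 < A := by positivity
  have hAM : 48 * M ≤ A := by
    rw [hA]; linarith [show 0 < (4 * K * M + 4000) / l0 by positivity]
  clear_value A K M
  refine ⟨A, hA0, fun k γ ε δ w hk hγ0 hγ1 hε hδ hL hwT => ?_⟩
  set L := Real.log (1 / δ) with hLdef
  set Λ := Real.log (k / δ) with hΛdef
  set g := γ ^ 2 * k / ε ^ 2 with hg
  set T := noiseScale A L Λ g ε with hT
  have hk' : (1 : ℝ) ≤ k := by exact_mod_cast hk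
  have hk0 : (0 : ℝ) < k := by linarith
  have hg0 : 0 < g := by positivity
  have hΛ : Λ = Real.log k + L := by
    rw [hΛdef, hLdef, Real.log_div hk0.ne' hδ.ne', one_div, Real.log_inv]; ring
  have hlogk : 0 ≤ Real.log k := Real.log_nonneg hk'
  have hLΛ : L ≤ Λ := by linarith
  have hLp : 0 < L := hl0.trans_le hL
  have hΛp : 0 < Λ := by linarith
  have hδL : δ = Real.exp (-L) := by
    rw [hLdef, one_div, Real.log_inv, neg_neg, Real.exp_log hδ]
  have hkΛ : δ / k = Real.exp (-Λ) := by
    rw [hΛdef, ← Real.log_inv, inv_div, Real.exp_log (by positivity)]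
  have hmin : L ≤ min Λ (L + g * Λ * (Λ + ε)) :=
    le_min hLΛ (by linarith [show 0 ≤ g * Λ * (Λ + ε) by positivity])
  have hT1 : A * (g * Λ * (L + ε)) ≤ T := by
    rw [hT, noiseScale]
    gcongr
    linarith
  have hT2 : A * L ≤ T := by
    rw [hT, noiseScale]
    gcongr
    linarith [show 0 ≤ g * Λ * (L + ε) by positivity]
  have hAL : 4000 ≤ A * L := by
    have h1 : A * l0 ≤ A * L := by gcongr
    have h2 : 0 ≤ 4 * K * M := by positivity
    linarith
  have hT0 : 4000 ≤ T := hAL.trans hT2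
  have hTp : 0 < T := by linarith
  have hw : (w : ℝ) = 1 / T := by field_simp; exact hwT
  have hw0 : (0 : ℝ≥0) < w := by
    have : (0 : ℝ) < w := by rw [hw]; positivity
    exact_mod_cast this
  have hw1 : w ≤ 1 := by
    have : (w : ℝ) ≤ 1 := by rw [hw]; exact (div_le_one hTp).2 (by linarith)
    exact_mod_cast this
  -- Then `lε = 2(L+1)`; with `kκ ≤ L+1` the Markov term is at most `e^(-L-1) = δ/e ≤ δ/2`. The
  -- other half of `δ` is spent on the tails, `δ/(2k)` for each coordinate.
  set l := 2 * (L + 1) / ε with hl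
  have hl0' : 0 ≤ l := by positivity
  set κ := K * w * γ ^ 2 * (l * (l + 1)) with hκ
  have hq : (k * w * γ ^ 2) * (A * Λ * (L + ε)) ≤ ε ^ 2 := by
    have : (k * w * γ ^ 2) * (A * Λ * (L + ε)) = ε ^ 2 * (A * (g * Λ * (L + ε)) / T) := by
      rw [hw, hg]; field_simp
    rw [this]
    exact mul_le_of_le_one_right (by positivity) ((div_le_one hTp).2 hT1)
  have hkκ : k * κ ≤ L + 1 := by
    have hAl' : 4 * K * (1 + 1 / l0) ≤ A * l0 := by rw [← hM]; linarith
    have := loss_exponent_le hl0 hL hLΛ hε (by linarith) hA0 hAl' hq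
    rw [← hl] at this
    refine le_trans (le_of_eq ?_) this
    rw [hκ]; ring
  have hfinal : k * (δ / (2 * k)) + Real.exp (-(l * ε) + k * κ) ≤ δ := by
    have e1 : k * (δ / (2 * k)) = δ / 2 := by field_simp
    have e2 : l * ε = 2 * (L + 1) := by rw [hl]; field_simp
    have e3 : Real.exp (-(l * ε) + k * κ) ≤ Real.exp (-L + -1) := by
      apply Real.exp_le_exp.2; rw [e2]; linarith
    have e4 : Real.exp (-1) ≤ 1 / 2 := by
      have := Real.add_one_le_exp (1 : ℝ)
      rw [Real.exp_neg, inv_le_comm₀ (Real.exp_pos _) (by norm_num)]; linarith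
    rw [Real.exp_add (-L) (-1), ← hδL] at e3
    have e5 := mul_le_mul_of_nonneg_left e4 hδ.le
    rw [e1]; linarith
  have htail : ∀ R : ℝ, Λ + 2 ≤ R ^ 2 * T / 4 → 4 ≤ T * R →
      ∫⁻ y in {y | |y| ≤ R}ᶜ, ENNReal.ofReal (mixDensity γ w 1 y) ∂gaussianReal 0 w
        ≤ ENNReal.ofReal (δ / (2 * k)) := by
    intro R h1 h2
    refine (lintegral_mixDensity_tail_le hγ0.le hγ1 hw0 (R := R) ?_).trans
      (ENNReal.ofReal_le_ofReal ?_)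
    · rw [hw, mul_one_div, div_le_iff₀ hTp]; linarith
    · have e : R ^ 2 / (4 * w) = R ^ 2 * T / 4 := by rw [hw]; field_simp
      have e5 : Real.exp (-2) ≤ 1 / 4 := by
        have := Real.quadratic_le_exp_of_nonneg (x := 2) (by norm_num)
        rw [Real.exp_neg, inv_le_comm₀ (Real.exp_pos _) (by norm_num)]; linarith
      have e6 : δ / (2 * k) = Real.exp (-Λ) / 2 := by rw [← hkΛ]; field_simp
      have e7 : Real.exp (-(R ^ 2 / (4 * w))) ≤ Real.exp (-Λ) * Real.exp (-2) := by
        rw [← Real.exp_add, e]; apply Real.exp_le_exp.2; linarith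
      have e8 := mul_le_mul_of_nonneg_left e5 (Real.exp_pos (-Λ)).le
      rw [e6]
      linarith
  have hML := add_one_le_mul hl0 hL
  rw [← hM] at hML
  have hexpκ : ∀ C : ℝ, C ≤ K → ENNReal.ofReal (Real.exp (C * w * γ ^ 2 * (l * (l + 1))))
      ≤ ENNReal.ofReal (Real.exp κ) := by
    intro C hC
    apply ENNReal.ofReal_le_ofReal; apply Real.exp_le_exp.2
    rw [hκ]; gcongr
  -- In the first case the minimum in the noise scale is at least `Λ/4`, so `w` is small enough for
  -- `R = 1`. In the second, `g(Λ+ε) < 1/4` and `L < Λ/4`, so `log k` carries most of `Λ`.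
  rcases le_or_gt Λ (4 * (L + g * Λ * (Λ + ε))) with hcase | hcase
  · refine ⟨1, l, δ / (2 * k), κ, hl0', by positivity, by positivity, htail 1 ?_ (by linarith), ?_,
      hfinal⟩
    · have hT3 : A * (Λ / 4) ≤ T := by
        rw [hT, noiseScale]
        gcongr
        have : Λ / 4 ≤ min Λ (L + g * Λ * (Λ + ε)) := le_min (by linarith) (by linarith)
        linarith [show 0 ≤ g * Λ * (L + ε) by positivity]
      have h2 : 48 * M * Λ ≤ A * Λ := by gcongr
      have h3 : M * l0 ≤ M * Λ := by gcongr; linarith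
      have h4 : Λ ≤ M * Λ := le_mul_of_one_le_left hΛp.le hM1.le
      linarith
    · exact (lintegral_ratio_rpow_le_of_le_one hγ0.le hγ1 hw1 hl0').trans (hexpκ _ hK400)
  · have hgΛ : 4 * g * (Λ + ε) < 1 := by
      by_contra h
      push Not at h
      linarith [mul_le_mul_of_nonneg_left h hΛp.le]
    have hL4 : L < Λ / 4 := by linarith [show 0 ≤ g * Λ * (Λ + ε) by positivity]
    have hlogk' : 3 / 4 * Λ < Real.log k := by linarith
    have hk2 : 2 ≤ k := by
      by_contra h
      have : k = 1 := by omega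
      rw [this] at hlogk'; simp at hlogk'; linarith
    have hlog2 : 1 / 2 ≤ Real.log k := by
      have h2 : (2 : ℝ) ≤ k := by exact_mod_cast hk2
      have := Real.log_le_log (by norm_num) h2
      linarith [Real.log_two_gt_d9]
    -- The tail needs `R²T/4 ≥ Λ + 2`, which holds as `log k ≥ 1/2` and `T ≥ 4000`; the divisor `8`
    -- keeps `R e^R ≤ e^(2R) = k^(1/4)`.
    set R := Real.log k / 8 with hR
    refine ⟨R, l, δ / (2 * k), κ, hl0', by positivity, by positivity, htail R ?_ ?_, ?_, hfinal⟩
    · have h1 : R ^ 2 * 4000 ≤ R ^ 2 * T := by gcongr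
      have h2 : R ^ 2 * 4000 / 4 = 1000 / 64 * Real.log k ^ 2 := by rw [hR]; ring
      have h3 := mul_le_mul_of_nonneg_left hlog2 hlogk
      linarith
    · have h1 : 4000 * (1 / 16) ≤ T * R := by gcongr; linarith
      linarith
    · refine (lintegral_ratio_rpow_le_of_bounded hγ0.le hγ1 hw0 hw1 hl0' (B := 2 * M) ?_).trans
        (hexpκ _ hK.ge)
      exact truncated_loss_le hk0 hγ0.le hε hM1 hΛp hLp hML hL4 hgΛ hlogk'

/-! ### The law of the output given the other clients, and privacy of the mechanism. -/

/-- The selection law of one coordinate of one client. -/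
noncomputable abbrev coin (γ : ℝ) : Measure Bool :=
  bernoulliMeasure true false (Set.projIcc (0 : ℝ) 1 zero_le_one γ)

lemma coe_projIcc {γ : ℝ} (h0 : 0 ≤ γ) (h1 : γ ≤ 1) :
    ((Set.projIcc (0 : ℝ) 1 zero_le_one γ : unitInterval) : ℝ) = γ := by
  rw [Set.projIcc_of_mem zero_le_one ⟨h0, h1⟩]

lemma lintegral_coin {γ : ℝ} (h0 : 0 ≤ γ) (h1 : γ ≤ 1) (F : Bool → ℝ≥0∞) :
    ∫⁻ β, F β ∂coin γ
      = ENNReal.ofReal γ * F true + ENNReal.ofReal (1 - γ) * F false := by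
  have e1 : ∀ p : unitInterval, ((unitInterval.toNNReal p : ℝ≥0) : ℝ≥0∞) = ENNReal.ofReal p := by
    intro p
    rw [← ENNReal.ofReal_coe_nnreal]; rfl
  rw [coin, bernoulliMeasure_def, lintegral_add_measure, lintegral_smul_measure,
    lintegral_smul_measure, lintegral_dirac, lintegral_dirac]
  simp only [ENNReal.smul_def, smul_eq_mul, e1, unitInterval.coe_symm_eq, coe_projIcc h0 h1]

lemma gaussianReal_eq_withDensity {w : ℝ≥0} (hw : w ≠ 0) (t : ℝ) :
    gaussianReal (t * w) w = (gaussianReal 0 w).withDensity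
      fun y => ENNReal.ofReal (Real.exp (t * y - t ^ 2 * w / 2)) := by
  have hw' : (w : ℝ) ≠ 0 := by exact_mod_cast hw
  rw [gaussianReal_of_var_ne_zero _ hw, gaussianReal_of_var_ne_zero _ hw,
    ← withDensity_mul _ (measurable_gaussianPDF _ _) (by fun_prop)]
  congr 1
  ext y
  rw [Pi.mul_apply, gaussianPDF_def, gaussianPDF_def, ← ENNReal.ofReal_mul
    (gaussianPDFReal_nonneg _ _ _), gaussianPDFReal_def, gaussianPDFReal_def]
  simp only
  rw [mul_assoc _ (Real.exp _) (Real.exp _), ← Real.exp_add]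
  congr 3
  field_simp
  ring

lemma mixture_eq_withDensity {γ : ℝ} (h0 : 0 ≤ γ) (h1 : γ ≤ 1) {w : ℝ≥0} (hw : w ≠ 0) (t : ℝ) :
    ENNReal.ofReal γ • gaussianReal (t * w) w + ENNReal.ofReal (1 - γ) • gaussianReal 0 w
      = (gaussianReal 0 w).withDensity fun y => ENNReal.ofReal (mixDensity γ w t y) := by
  rw [gaussianReal_eq_withDensity hw, ← withDensity_smul _ (by fun_prop)]
  conv_lhs => enter [2, 2]; rw [← withDensity_one (μ := gaussianReal 0 w)]
  rw [← withDensity_smul _ (by fun_prop), ← withDensity_add_left (by fun_prop)]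
  congr 1
  ext y
  simp only [Pi.add_apply, Pi.smul_apply, smul_eq_mul, Pi.one_apply, mul_one]
  rw [← ENNReal.ofReal_mul h0, ← ENNReal.ofReal_add (by positivity) (by linarith), mixDensity,
    add_comm]

/-- The law of one rescaled coordinate of the output. -/
lemma map_coin_prod_gaussian {γ : ℝ} (h0 : 0 ≤ γ) (h1 : γ ≤ 1) {v w : ℝ≥0} (hw : w ≠ 0)
    {r m t : ℝ} (hr : r ^ 2 * v = w) (hm : r * m = t * w) :
    ((coin γ).prod (gaussianReal 0 v)).map
        (fun p : Bool × ℝ => r * ((if p.1 then m else 0) + p.2))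
      = (gaussianReal 0 w).withDensity fun y => ENNReal.ofReal (mixDensity γ w t y) := by
  have hmeas : Measurable fun p : Bool × ℝ => r * ((if p.1 then m else 0) + p.2) := by
    refine Measurable.const_mul (Measurable.add ?_ measurable_snd) _
    exact (measurable_of_finite fun b : Bool => if b then m else 0).comp measurable_fst
  have hlaw : ∀ s : ℝ, (gaussianReal 0 v).map (fun y => r * (s + y))
      = gaussianReal (r * s) w := by
    intro s
    have e : (fun y => r * (s + y)) = (fun y => r * y) ∘ (fun y => s + y) := rfl
    rw [e, ← Measure.map_map (by fun_prop) (by fun_prop), gaussianReal_map_const_add,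
      gaussianReal_map_const_mul, zero_add]
    congr 1
    ext; push_cast; simpa using hr
  rw [← mixture_eq_withDensity h0 h1 hw]
  ext s hs
  rw [Measure.map_apply hmeas hs, Measure.prod_apply (hmeas hs), lintegral_coin h0 h1]
  have e : ∀ β : Bool, (gaussianReal 0 v) (Prod.mk β ⁻¹'
        ((fun p : Bool × ℝ => r * ((if p.1 then m else 0) + p.2)) ⁻¹' s))
      = gaussianReal (r * if β then m else 0) w s := by
    intro β
    rw [← hlaw, Measure.map_apply (by fun_prop) hs]; rfl
  rw [e, e]
  simp [hm]

lemma map_prod_pi_eq_pi_map {ι X Y Z : Type*} [Fintype ι] [MeasurableSpace X] [MeasurableSpace Y]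
    [MeasurableSpace Z] (μ : Measure X) (ν : Measure Y) [IsProbabilityMeasure μ]
    [IsProbabilityMeasure ν] {f : ι → X × Y → Z} (hf : ∀ i, Measurable (f i)) :
    ((Measure.pi fun _ : ι => μ).prod (Measure.pi fun _ : ι => ν)).map
        (fun p i => f i (p.1 i, p.2 i))
      = Measure.pi fun i => (μ.prod ν).map (f i) := by
  have : ∀ i, IsProbabilityMeasure ((μ.prod ν).map (f i)) := fun i =>
    Measure.isProbabilityMeasure_map (hf i).aemeasurable
  rw [← Measure.pi_map_pi fun i => (hf i).aemeasurable,
    ← (measurePreserving_arrowProdEquivProdArrow X Y ι (fun _ => μ) (fun _ => ν)).map_eq,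
    Measure.map_map _ (MeasurableEquiv.measurable _)]
  · rfl
  · refine measurable_pi_lambda _ fun i => (hf i).comp ?_
    fun_prop

/-- Resampling one coordinate independently preserves a product law. This isolates the selections of
one client without splitting the index set. -/
lemma map_update_pi {ι X : Type*} [Fintype ι] [DecidableEq ι] [MeasurableSpace X] (μ : Measure X)
    [IsProbabilityMeasure μ] (i : ι) :
    MeasurePreserving (fun p : (ι → X) × X => Function.update p.1 i p.2)
      ((Measure.pi fun _ => μ).prod μ) (Measure.pi fun _ => μ) := by
  have hm : Measurable fun p : (ι → X) × X => Function.update p.1 i p.2 := by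
    refine measurable_pi_lambda _ fun k => ?_
    by_cases h : k = i
    · subst h; simpa using measurable_snd
    · simp only [Function.update_of_ne h]; fun_prop
  refine ⟨hm, (Measure.pi_eq fun s hs => ?_).symm⟩
  rw [Measure.map_apply hm (MeasurableSet.univ_pi hs)]
  have e : (fun p : (ι → X) × X => Function.update p.1 i p.2) ⁻¹' (Set.univ.pi s)
      = (Set.univ.pi (Function.update s i Set.univ)) ×ˢ (s i) := by
    ext ⟨p, q⟩
    simp only [Set.mem_preimage, Set.mem_pi, Set.mem_univ, true_implies, Set.mem_prod]
    constructor
    · intro h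
      refine ⟨fun k => ?_, by simpa using h i⟩
      by_cases hk : k = i
      · subst hk; simp
      · simpa [Function.update_of_ne hk] using h k
    · rintro ⟨h, h'⟩ k
      by_cases hk : k = i
      · subst hk; simpa using h'
      · simpa [Function.update_of_ne hk] using h k
  rw [e, Measure.prod_prod, Measure.pi_pi, ← Finset.prod_erase_mul Finset.univ _
    (Finset.mem_univ i), ← Finset.prod_erase_mul Finset.univ (fun k => μ (s k))
    (Finset.mem_univ i)]
  simp only [Function.update_self, measure_univ, mul_one]
  congr 1
  refine Finset.prod_congr rfl fun k hk => ?_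
  rw [Function.update_of_ne (Finset.ne_of_mem_erase hk)]

/-- The randomness of one client and the noise, given the selections of the other clients. -/
lemma csgmRandomness_apply {n d : ℕ} (γ : ℝ) (v : ℝ≥0) (i : Fin n)
    {B : Set ((Fin n → Fin d → Bool) × (Fin d → ℝ))} (hB : MeasurableSet B) :
    csgmRandomness n (Fin d) γ v B
      = ∫⁻ z, ((Measure.pi fun _ : Fin d => coin γ).prod
          (Measure.pi fun _ : Fin d => gaussianReal 0 v))
          {p | (Function.update z i p.1, p.2) ∈ B}
          ∂(Measure.pi fun _ : Fin n => Measure.pi fun _ : Fin d => coin γ) := by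
  have h := ((map_update_pi (ι := Fin n) (Measure.pi fun _ : Fin d => coin γ) i).prod
    (MeasurePreserving.id (Measure.pi fun _ : Fin d => gaussianReal 0 v)))
  have h2 := h.comp ((measurePreserving_prodAssoc
    (Measure.pi fun _ : Fin n => Measure.pi fun _ : Fin d => coin γ)
    (Measure.pi fun _ : Fin d => coin γ) (Measure.pi fun _ : Fin d => gaussianReal 0 v)).symm)
  have h3 := h2.measure_preimage hB.nullMeasurableSet
  rw [csgmRandomness, ← h3, Measure.prod_apply (h2.measurable hB)]
  rfl

lemma decodeBit_encodeBit {c v : ℝ} (hc : 0 < c) (hv : v = -c ∨ v = c) :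
    decodeBit c (encodeBit v) = v := by
  rcases hv with rfl | rfl
  · simp [decodeBit, encodeBit, hc.le]
  · simp [decodeBit, encodeBit, hc]

lemma preselect_apply {n d d' : ℕ} {c b : ℝ} (hc : 0 < c) {x : Fin n → Fin d → ℝ}
    (hx : ∀ i, x i ∈ signCube d c) (ω : Coins n d) (j : Fin d) :
    preselect c b d' x ω j = ((d : ℝ) / d') * if j ∈ ω.1 then
      1 / ((n : ℝ) * (b / d')) * (∑ i, if ω.2.1 i j then x i j else 0) + ω.2.2 j else 0 := by
  unfold preselect
  congr 1
  by_cases hj : j ∈ ω.1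
  · simp only [hj, dif_pos, if_true, csgm, server, message]
    congr 2
    refine Finset.sum_congr rfl fun i _ => ?_
    by_cases hz : ω.2.1 i j
    · simp [hz, decodeBit_encodeBit hc (hx i j)]
    · simp [hz]
  · simp [hj]

lemma measurable_selected (n d : ℕ) (i : Fin n) (j : Fin d) (u : ℝ) :
    Measurable fun ω : Coins n d => if ω.2.1 i j then u else 0 :=
  (measurable_of_finite fun β : Bool => if β then u else 0).comp
    (show Measurable fun ω : Coins n d => ω.2.1 i j by fun_prop)

lemma measurable_preselect {n d d' : ℕ} {c b : ℝ} (hc : 0 < c) {x : Fin n → Fin d → ℝ}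
    (hx : ∀ i, x i ∈ signCube d c) : Measurable (preselect c b d' x) := by
  refine measurable_pi_lambda _ fun j => ?_
  simp_rw [preselect_apply hc hx]
  refine Measurable.const_mul (Measurable.ite ?_ ?_ measurable_const) _
  · exact (measurableSet_mem_finset j).preimage measurable_fst
  · refine Measurable.add (Measurable.const_mul (Finset.measurable_sum _ fun i _ => ?_) _)
      (by fun_prop)
    exact measurable_selected n d i j _

lemma ae_card_eq (d d' : ℕ) :
    ∀ᵐ J ∂uniformOn {J : Finset (Fin d) | J.card = d'}, J.card = d' :=
  ae_cond_mem (Set.toFinite _).measurableSet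

lemma isProbabilityMeasure_uniformOn_card {d d' : ℕ} (h : d' ≤ d) :
    IsProbabilityMeasure (uniformOn {J : Finset (Fin d) | J.card = d'}) := by
  refine isProbabilityMeasure_uniformOn (Set.toFinite _) ?_
  obtain ⟨J, hJ⟩ := Finset.exists_subset_card_eq (s := (Finset.univ : Finset (Fin d))) (n := d')
    (by simpa using h)
  exact ⟨J, hJ.2⟩

/-- Given `J` and the selections of the other clients, the output is a function, the same for
neighbouring datasets, of a vector with independent mixture coordinates. -/
lemma prod_pi_preselect_eq {n d d' : ℕ} {c b : ℝ} (hc : 0 < c) (hn : 0 < n) (hb : 0 < b / d')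
    (hb1 : b / d' ≤ 1) {v w : ℝ≥0} (hv : v ≠ 0)
    (hw : (w : ℝ) = (c / (n * (b / d'))) ^ 2 / v)
    {x : Fin n → Fin d → ℝ} (hx : ∀ i, x i ∈ signCube d c) (i : Fin n) (J : Finset (Fin d))
    (z : Fin n → Fin d → Bool) {S : Set (Fin d → ℝ)} (hS : MeasurableSet S) :
    ((Measure.pi fun _ : Fin d => coin (b / d')).prod
        (Measure.pi fun _ : Fin d => gaussianReal 0 v))
        {p | preselect c b d' x (J, Function.update z i p.1, p.2) ∈ S}
      = Measure.pi (fun j => (gaussianReal 0 w).withDensity fun y =>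
          ENNReal.ofReal (mixDensity (b / d') w (if j ∈ J then x i j / c else 0) y))
        {u | (fun j => ((d : ℝ) / d') * if j ∈ J then
          1 / ((n : ℝ) * (b / d')) * (∑ k ∈ Finset.univ.erase i, if z k j then x k j else 0)
            + v / (c / (n * (b / d'))) * u j else 0) ∈ S} := by
  set γ := b / d' with hγ
  -- `a` is the size of one client's contribution to a coordinate. Multiplying by `a/v` turns noise
  -- variance `v` into `a²/v = w` and the shift `±a` into `±w`.
  set a := c / (n * γ) with ha
  have hn' : (0 : ℝ) < n := by exact_mod_cast hn
  have ha0 : 0 < a := by positivity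
  have hv0 : (0 : ℝ) < v := by exact_mod_cast pos_iff_ne_zero.2 hv
  have hw0 : w ≠ 0 := by
    have : (0 : ℝ) < w := by rw [hw]; positivity
    exact_mod_cast this.ne'
  have hmf : ∀ j, Measurable fun p : Bool × ℝ =>
      a / v * ((if p.1 then a * (if j ∈ J then x i j / c else 0) else 0) + p.2) := fun j =>
    Measurable.const_mul (Measurable.add
      ((measurable_of_finite fun β : Bool => if β then a * (if j ∈ J then x i j / c else 0)
        else 0).comp measurable_fst) measurable_snd) _
  have hlaw : ∀ j, ((coin γ).prod (gaussianReal 0 v)).map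
        (fun p : Bool × ℝ =>
          a / v * ((if p.1 then a * (if j ∈ J then x i j / c else 0) else 0) + p.2))
      = (gaussianReal 0 w).withDensity fun y =>
        ENNReal.ofReal (mixDensity γ w (if j ∈ J then x i j / c else 0) y) := fun j =>
    map_coin_prod_gaussian hb.le hb1 hw0 (by rw [hw]; field_simp)
      (by rw [hw]; field_simp)
  simp_rw [← hlaw]
  rw [← map_prod_pi_eq_pi_map _ _ hmf, Measure.map_apply]
  · congr 1
    ext p
    simp only [Set.mem_preimage, Set.mem_ofPred_eq]
    have : preselect c b d' x (J, Function.update z i p.1, p.2)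
        = fun j => ((d : ℝ) / d') * if j ∈ J then
          1 / ((n : ℝ) * γ) * (∑ k ∈ Finset.univ.erase i, if z k j then x k j else 0)
            + v / a * (a / v * ((if p.1 j then a * (if j ∈ J then x i j / c else 0) else 0)
              + p.2 j)) else 0 := by
      ext j
      rw [preselect_apply hc hx]
      congr 1
      by_cases hj : j ∈ J
      · simp only [hj, if_true]
        have hsum : (∑ k, if Function.update z i p.1 k j then x k j else 0)
            = (∑ k ∈ Finset.univ.erase i, if z k j then x k j else 0)
              + if p.1 j then x i j else 0 := by
          rw [← Finset.sum_erase_add _ _ (Finset.mem_univ i)]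
          congr 1
          · refine Finset.sum_congr rfl fun k hk => ?_
            simp only [Function.update_of_ne (Finset.ne_of_mem_erase hk)]
          · simp only [Function.update_self]
        rw [hsum, ← mul_assoc ((v : ℝ) / a), div_mul_div_cancel₀ ha0.ne', div_self hv0.ne',
          one_mul, mul_add, add_assoc]
        congr 2
        · by_cases hp : p.1 j
          · simp only [hp, if_true]; rw [← hγ, ha]; field_simp
          · simp [hp]
      · simp [hj]
    rw [this]
  · exact measurable_pi_lambda _ fun j => (hmf j).comp (by fun_prop)
  · refine hS.preimage (measurable_pi_lambda _ fun j => Measurable.const_mul ?_ _)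
    by_cases hj : j ∈ J
    · simp only [hj, if_true]; fun_prop
    · simp only [hj, if_false]; fun_prop

/-- Differential privacy of the mechanism with coordinate pre-selection. -/
lemma preselect_isDP {n d d' : ℕ} {c b ε δ : ℝ} (hc : 0 < c) (hd : d' ≤ d)
    (hb : 0 < b / d') (hb1 : b / d' ≤ 1) {v w : ℝ≥0} (hv : v ≠ 0)
    (hw : (w : ℝ) = (c / (n * (b / d'))) ^ 2 / v)
    {R l η κ : ℝ} (hl : 0 ≤ l) (hη0 : 0 ≤ η) (hκ0 : 0 ≤ κ)
    (hη : ∫⁻ y in {y | |y| ≤ R}ᶜ, ENNReal.ofReal (mixDensity (b / d') w 1 y) ∂gaussianReal 0 w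
      ≤ ENNReal.ofReal η)
    (hκ : ∫⁻ y in {y | |y| ≤ R}, ENNReal.ofReal (mixDensity (b / d') w 1 y
        * (mixDensity (b / d') w 1 y / mixDensity (b / d') w (-1) y) ^ l) ∂gaussianReal 0 w
      ≤ ENNReal.ofReal (Real.exp κ))
    (hδ : d' * η + Real.exp (-(l * ε) + d' * κ) ≤ δ) :
    IsDP ε δ (preselectRandomness n d d' (b / d') v)
      (fun x : Fin n → signCube d c => preselect c b d' fun i => (x i : Fin d → ℝ)) := by
  have hU := isProbabilityMeasure_uniformOn_card hd
  rintro x x' ⟨i, hi⟩ S hS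
  have hn : 0 < n := i.pos
  have hmem : ∀ x : Fin n → signCube d c, ∀ i, (x i : Fin d → ℝ) ∈ signCube d c :=
    fun x i => (x i).2
  have expand : ∀ x : Fin n → signCube d c,
      preselectRandomness n d d' (b / d') v
        {ω | preselect c b d' (fun i => (x i : Fin d → ℝ)) ω ∈ S}
      = ∫⁻ J, ∫⁻ z, ((Measure.pi fun _ : Fin d => coin (b / d')).prod
          (Measure.pi fun _ : Fin d => gaussianReal 0 v))
          {p | preselect c b d' (fun i => (x i : Fin d → ℝ)) (J, Function.update z i p.1, p.2) ∈ S}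
          ∂(Measure.pi fun _ : Fin n => Measure.pi fun _ : Fin d => coin (b / d'))
          ∂uniformOn {J : Finset (Fin d) | J.card = d'} := by
    intro x
    have hm := measurable_preselect (d' := d') (b := b) hc (hmem x) hS
    have : IsProbabilityMeasure (csgmRandomness n (Fin d) (b / d') v) := by
      unfold csgmRandomness; infer_instance
    rw [preselectRandomness, show {ω | preselect c b d' (fun i => (x i : Fin d → ℝ)) ω ∈ S}
      = preselect c b d' (fun i => (x i : Fin d → ℝ)) ⁻¹' S from rfl, Measure.prod_apply hm]
    refine lintegral_congr fun J => ?_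
    rw [csgmRandomness_apply (b / d') v i (measurable_prodMk_left hm)]
    rfl
  rw [expand x, expand x']
  have inner : ∀ J : Finset (Fin d), J.card = d' → ∀ z,
      ((Measure.pi fun _ : Fin d => coin (b / d')).prod
          (Measure.pi fun _ : Fin d => gaussianReal 0 v))
          {p | preselect c b d' (fun i => (x i : Fin d → ℝ)) (J, Function.update z i p.1, p.2) ∈ S}
      ≤ ENNReal.ofReal (Real.exp ε) * ((Measure.pi fun _ : Fin d => coin (b / d')).prod
          (Measure.pi fun _ : Fin d => gaussianReal 0 v))
          {p | preselect c b d' (fun i => (x' i : Fin d → ℝ)) (J, Function.update z i p.1, p.2) ∈ S}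
        + ENNReal.ofReal δ := by
    intro J hJ z
    rw [prod_pi_preselect_eq hc hn hb hb1 hv hw (hmem x) i J z hS,
      prod_pi_preselect_eq hc hn hb hb1 hv hw (hmem x') i J z hS]
    -- Neighbours agree off `i`, so both outputs are the same post-processing of the two mixture
    -- vectors.
    have e : ∀ j, ∑ k ∈ Finset.univ.erase i, (if z k j then (x' k : Fin d → ℝ) j else 0)
        = ∑ k ∈ Finset.univ.erase i, if z k j then (x k : Fin d → ℝ) j else 0 := fun j =>
      Finset.sum_congr rfl fun k hk => by rw [hi k (Finset.ne_of_mem_erase hk)]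
    simp_rw [e]
    have hsign : ∀ x : Fin n → signCube d c, ∀ j ∈ J,
        (if j ∈ J then (x i : Fin d → ℝ) j / c else 0) = 1 ∨
          (if j ∈ J then (x i : Fin d → ℝ) j / c else 0) = -1 := by
      intro x j hj
      rw [if_pos hj]
      rcases hmem x i j with h | h <;> rw [h]
      · right; field_simp
      · left; field_simp
    refine (pi_mixture_le hb.le hb1 w hl hη0 hη hκ0 hκ J _ _ (hsign x) (hsign x')
      (fun j hj => if_neg hj) (fun j hj => if_neg hj) (ε := ε) ?_).trans ?_
    · refine hS.preimage (measurable_pi_lambda _ fun j => Measurable.const_mul ?_ _)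
      by_cases hj : j ∈ J
      · simp only [hj, if_true]; fun_prop
      · simp only [hj, if_false]; fun_prop
    · rw [hJ]
      gcongr
  calc _ ≤ ∫⁻ J, (ENNReal.ofReal (Real.exp ε)
        * (∫⁻ z, ((Measure.pi fun _ : Fin d => coin (b / d')).prod
          (Measure.pi fun _ : Fin d => gaussianReal 0 v))
          {p | preselect c b d' (fun i => (x' i : Fin d → ℝ)) (J, Function.update z i p.1, p.2) ∈ S}
          ∂(Measure.pi fun _ : Fin n => Measure.pi fun _ : Fin d => coin (b / d')))
        + ENNReal.ofReal δ) ∂uniformOn {J : Finset (Fin d) | J.card = d'} := by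
        refine lintegral_mono_ae ((ae_card_eq d d').mono fun J hJ => ?_)
        refine (lintegral_mono (inner J hJ)).trans_eq ?_
        rw [lintegral_add_right _ measurable_const, lintegral_const_mul' _ _ ENNReal.ofReal_ne_top,
          lintegral_const, measure_univ, mul_one]
    _ = _ := by
        rw [lintegral_add_right _ measurable_const, lintegral_const_mul' _ _ ENNReal.ofReal_ne_top,
          lintegral_const, measure_univ, mul_one]

/-! ### Bias, squared error and communication. -/

/-- Counts the sets avoiding `j`: there are `C(d-1, d')`, and `d · C(d-1, d') = (d - d') · C(d,
d')`. -/
lemma uniformOn_mem {d d' : ℕ} (hd : 1 ≤ d) (hdd : d' ≤ d) (j : Fin d) :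
    (uniformOn {J : Finset (Fin d) | J.card = d'}).real {J | j ∈ J} = (d' : ℝ) / d := by
  classical
  have e1 : {J : Finset (Fin d) | J.card = d'}
      = ((Finset.univ.powersetCard d' : Finset (Finset (Fin d))) : Set (Finset (Fin d))) := by
    ext J; simp
  have e2 : {J : Finset (Fin d) | j ∈ J}
      = ((Finset.univ.filter fun J : Finset (Fin d) => j ∈ J) : Set (Finset (Fin d))) := by
    ext J; simp
  rw [measureReal_def, e1, e2, uniformOn_apply_finset, ENNReal.toReal_div]
  simp only [ENNReal.toReal_natCast]
  have hc : (Finset.univ.powersetCard d' : Finset (Finset (Fin d))).card = d.choose d' := by simp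
  have hnot : ((Finset.univ.powersetCard d' : Finset (Finset (Fin d))).filter
      fun J => ¬ j ∈ J).card = (d - 1).choose d' := by
    have : (Finset.univ.powersetCard d' : Finset (Finset (Fin d))).filter (fun J => ¬ j ∈ J)
        = (Finset.univ.erase j).powersetCard d' := by
      ext J
      simp only [Finset.mem_filter, Finset.mem_powersetCard, Finset.subset_univ, true_and,
        Finset.subset_erase]
      tauto
    rw [this, Finset.card_powersetCard, Finset.card_erase_of_mem (Finset.mem_univ j)]
    simp
  have hsum := Finset.card_filter_add_card_filter_not
    (s := (Finset.univ.powersetCard d' : Finset (Finset (Fin d)))) (fun J => j ∈ J)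
  rw [hnot, hc] at hsum
  have hinter : (Finset.univ.powersetCard d' : Finset (Finset (Fin d))) ∩
      (Finset.univ.filter fun J : Finset (Fin d) => j ∈ J)
      = (Finset.univ.powersetCard d' : Finset (Finset (Fin d))).filter fun J => j ∈ J := by
    ext J; simp
  rw [hinter, hc]
  set N := ((Finset.univ.powersetCard d' : Finset (Finset (Fin d))).filter fun J => j ∈ J).card
  have hpos : 0 < d.choose d' := Nat.choose_pos hdd
  have hmul := Nat.choose_mul_succ_eq (d - 1) d'
  rw [Nat.sub_add_cancel hd] at hmul
  have h1 : (N : ℝ) + (d - 1).choose d' = d.choose d' := by exact_mod_cast hsum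
  have h2 : ((d - 1).choose d' : ℝ) * d = d.choose d' * (d - d') := by
    rw [← Nat.cast_sub hdd]; exact_mod_cast hmul
  have hpos' : (0 : ℝ) < d.choose d' := by exact_mod_cast hpos
  have hd' : (0 : ℝ) < d := by exact_mod_cast hd
  rw [div_eq_div_iff hpos'.ne' hd'.ne']
  linear_combination h1 * d - h2

lemma integral_indicator_mem {d d' : ℕ} (hd : 1 ≤ d) (hdd : d' ≤ d) (j : Fin d) :
    ∫ J, (if j ∈ J then (1 : ℝ) else 0) ∂uniformOn {J : Finset (Fin d) | J.card = d'}
      = (d' : ℝ) / d := by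
  rw [← uniformOn_mem hd hdd j, ← integral_indicator_one (measurableSet_mem_finset j)]
  refine integral_congr_ae (Filter.Eventually.of_forall fun J => ?_)
  by_cases h : j ∈ J <;> simp [Set.indicator, h]

lemma integral_coin {γ : ℝ} (h0 : 0 ≤ γ) (h1 : γ ≤ 1) (u : ℝ) :
    ∫ β, (if β then u else 0) ∂coin γ = γ * u := by
  rw [coin, integral_bernoulliMeasure, coe_projIcc h0 h1]; simp

lemma variance_coin {γ : ℝ} (h0 : 0 ≤ γ) (h1 : γ ≤ 1) (u : ℝ) :
    Var[fun β : Bool => if β then u else 0; coin γ] = γ * (1 - γ) * u ^ 2 := by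
  rw [variance_eq_sub (MemLp.of_discrete), integral_coin h0 h1]
  have : (fun β : Bool => if β then u else 0) ^ 2 = fun β : Bool => if β then u ^ 2 else 0 := by
    ext β; cases β <;> simp
  rw [this, integral_coin h0 h1]
  ring

section Moments

variable {n d : ℕ} {γ : ℝ} (x : Fin n → Fin d → ℝ) (j : Fin d)

/-- The estimate of the mean of coordinate `j` before the scaling by `d / d'`. -/
noncomputable def estimate (γ : ℝ) (x : Fin n → Fin d → ℝ) (j : Fin d)
    (p : (Fin n → Fin d → Bool) × (Fin d → ℝ)) : ℝ :=
  (1 / ((n : ℝ) * γ)) * (∑ i, if p.1 i j then x i j else 0) + p.2 j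

/-- The law of the selections of all clients. -/
noncomputable abbrev selections (n d : ℕ) (γ : ℝ) : Measure (Fin n → Fin d → Bool) :=
  Measure.pi fun _ : Fin n => Measure.pi fun _ : Fin d => coin γ

lemma integral_selection (h0 : 0 ≤ γ) (h1 : γ ≤ 1) (i : Fin n) (u : ℝ) :
    ∫ z, (if z i j then u else 0) ∂selections n d γ = γ * u := by
  rw [← integral_coin h0 h1 u]
  have e1 := integral_comp_eval (μ := fun _ : Fin n => Measure.pi fun _ : Fin d => coin γ) (i := i)
    (f := fun ζ : Fin d → Bool => if ζ j then u else 0) (by fun_prop)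
  have e2 := integral_comp_eval (μ := fun _ : Fin d => coin γ) (i := j)
    (f := fun β : Bool => if β then u else 0) (by fun_prop)
  exact e1.trans e2

lemma variance_selection_sum (h0 : 0 ≤ γ) (h1 : γ ≤ 1) :
    Var[fun z => ∑ i, if z i j then x i j else 0; selections n d γ]
      = ∑ i, γ * (1 - γ) * x i j ^ 2 := by
  have h := variance_sum_pi (μ := fun _ : Fin n => Measure.pi fun _ : Fin d => coin γ)
    (X := fun i (ζ : Fin d → Bool) => if ζ j then x i j else 0) (fun i => MemLp.of_discrete)
  have e : (∑ i, fun z : Fin n → Fin d → Bool => if z i j then x i j else 0)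
      = fun z => ∑ i, if z i j then x i j else 0 := by ext z; simp
  rw [e] at h
  rw [h]
  refine Finset.sum_congr rfl fun i _ => ?_
  rw [← variance_coin h0 h1]
  have hmp := measurePreserving_eval (fun _ : Fin d => coin γ) j
  have hv := variance_map (X := fun β : Bool => if β then x i j else 0)
    (μ := Measure.pi fun _ : Fin d => coin γ) (Y := Function.eval j) (by fun_prop)
    hmp.measurable.aemeasurable
  rw [hmp.map_eq] at hv
  exact hv.symm

lemma estimate_eq (p : (Fin n → Fin d → Bool) × (Fin d → ℝ)) :
    estimate γ x j p
      = (1 / ((n : ℝ) * γ)) * (∑ i, if p.1 i j then x i j else 0) + p.2 j := rfl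

lemma integral_selection_sum (h0 : 0 ≤ γ) (h1 : γ ≤ 1) :
    ∫ z, (∑ i, if z i j then x i j else 0) ∂selections n d γ = γ * ∑ i, x i j := by
  rw [integral_finsetSum _ fun i _ => Integrable.of_finite, Finset.mul_sum]
  exact Finset.sum_congr rfl fun i _ => integral_selection j h0 h1 i _

lemma integral_selection_sum_sq (h0 : 0 ≤ γ) (h1 : γ ≤ 1) :
    ∫ z, (∑ i, if z i j then x i j else 0) ^ 2 ∂selections n d γ
      = γ * (1 - γ) * ∑ i, x i j ^ 2 + (γ * ∑ i, x i j) ^ 2 := by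
  have h := variance_selection_sum x j h0 h1
  rw [variance_eq_sub MemLp.of_discrete, integral_selection_sum x j h0 h1, ← Finset.mul_sum] at h
  rw [← h]
  simp [Pi.pow_apply]

lemma integral_noise (v : ℝ≥0) :
    ∫ u : Fin d → ℝ, u j ∂(Measure.pi fun _ => gaussianReal 0 v) = 0 := by
  rw [integral_comp_eval (μ := fun _ : Fin d => gaussianReal 0 v) (i := j) (f := fun y : ℝ => y)
    (by fun_prop), integral_id_gaussianReal]

lemma integral_noise_sq (v : ℝ≥0) :
    ∫ u : Fin d → ℝ, u j ^ 2 ∂(Measure.pi fun _ => gaussianReal 0 v) = v := by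
  rw [integral_comp_eval (μ := fun _ : Fin d => gaussianReal 0 v) (i := j)
    (f := fun y : ℝ => y ^ 2) (by fun_prop)]
  have h := variance_id_gaussianReal (μ := 0) (v := v)
  rw [variance_eq_sub (memLp_id_gaussianReal 2)] at h
  simpa using h

lemma memLp_noise (v : ℝ≥0) :
    MemLp (fun u : Fin d → ℝ => u j) 2 (Measure.pi fun _ => gaussianReal 0 v) :=
  (memLp_id_gaussianReal (μ := 0) (v := v) 2).comp_measurePreserving
    (measurePreserving_eval (fun _ : Fin d => gaussianReal 0 v) j)

lemma memLp_estimate (v : ℝ≥0) :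
    MemLp (estimate γ x j) 2 (csgmRandomness n (Fin d) γ v) := by
  have h1 : MemLp (fun z : Fin n → Fin d → Bool =>
      (1 / ((n : ℝ) * γ)) * (∑ i, if z i j then x i j else 0)) 2 (selections n d γ) :=
    MemLp.of_discrete
  exact (h1.comp_fst _).add ((memLp_noise j v).comp_snd _)

lemma integral_estimate (hn : 0 < n) (h0 : 0 < γ) (h1 : γ ≤ 1) (v : ℝ≥0) :
    ∫ p, estimate γ x j p ∂csgmRandomness n (Fin d) γ v = mean x j := by
  have hn' : (0 : ℝ) < n := by exact_mod_cast hn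
  have i1 : Integrable (fun z : Fin n → Fin d → Bool =>
      (1 / ((n : ℝ) * γ)) * (∑ i, if z i j then x i j else 0)) (selections n d γ) :=
    Integrable.of_finite
  have i2 := (memLp_noise j v).integrable one_le_two
  simp_rw [estimate_eq, csgmRandomness]
  rw [integral_add (i1.comp_fst _) (i2.comp_snd _),
    integral_fun_fst (fun z : Fin n → Fin d → Bool =>
      (1 / ((n : ℝ) * γ)) * (∑ i, if z i j then x i j else 0)),
    integral_fun_snd (fun u : Fin d → ℝ => u j), integral_noise, integral_const_mul,
    integral_selection_sum x j h0.le h1]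
  simp only [probReal_univ, one_smul, mean]
  field_simp
  ring

/-- The cross term vanishes because the noise is centred and independent of the selections; the
entries `±c` make the sampling variance independent of the data. -/
lemma integral_estimate_sq {c : ℝ} (hn : 0 < n) (h0 : 0 < γ) (h1 : γ ≤ 1) (v : ℝ≥0)
    (hx : ∀ i, x i ∈ signCube d c) :
    ∫ p, estimate γ x j p ^ 2 ∂csgmRandomness n (Fin d) γ v
      = mean x j ^ 2 + c ^ 2 * (1 - γ) / (n * γ) + v := by
  have hn' : (0 : ℝ) < n := by exact_mod_cast hn
  set s : (Fin n → Fin d → Bool) → ℝ := fun z => ∑ i, if z i j then x i j else 0 with hs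
  set a : ℝ := 1 / ((n : ℝ) * γ) with ha
  have e : ∀ p, estimate γ x j p ^ 2
      = a ^ 2 * s p.1 ^ 2 + (2 * a * s p.1) * p.2 j + p.2 j ^ 2 := by
    intro p
    rw [estimate_eq, ← ha]
    ring
  have i1 : Integrable (fun z => a ^ 2 * s z ^ 2) (selections n d γ) := Integrable.of_finite
  have i2 := (memLp_noise j v).integrable one_le_two
  have i3 : Integrable (fun z => 2 * a * s z) (selections n d γ) := Integrable.of_finite
  have i4 := (memLp_noise j v).integrable_sq
  have i5 : Integrable (fun p : (Fin n → Fin d → Bool) × (Fin d → ℝ) =>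
      a ^ 2 * s p.1 ^ 2 + (2 * a * s p.1) * p.2 j)
      ((selections n d γ).prod (Measure.pi fun _ => gaussianReal 0 v)) :=
    (i1.comp_fst _).add (i3.mul_prod i2)
  simp_rw [e, csgmRandomness]
  rw [integral_add i5 (i4.comp_snd _),
    integral_add (i1.comp_fst _) (i3.mul_prod i2),
    integral_fun_fst (fun z => a ^ 2 * s z ^ 2), integral_fun_snd (fun u : Fin d → ℝ => u j ^ 2),
    integral_prod_mul (fun z => 2 * a * s z) (fun u : Fin d → ℝ => u j), integral_noise,
    integral_noise_sq, integral_const_mul, integral_selection_sum_sq x j h0.le h1]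
  have hc : ∑ i, x i j ^ 2 = n * c ^ 2 := by
    have : ∀ i, x i j ^ 2 = c ^ 2 := fun i => by rcases hx i j with h | h <;> rw [h]; ring
    simp [this]
  rw [hc]
  simp only [probReal_univ, one_smul, mean, ha]
  field_simp
  ring

end Moments

section Preselect

variable {n d d' : ℕ} {b c : ℝ} {x : Fin n → Fin d → ℝ}

lemma preselect_eq_mul_estimate (hc : 0 < c) (hx : ∀ i, x i ∈ signCube d c) (ω : Coins n d)
    (j : Fin d) :
    preselect c b d' x ω j
      = (d / d' * if j ∈ ω.1 then (1 : ℝ) else 0) * estimate (b / d') x j ω.2 := by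
  rw [preselect_apply hc hx, estimate]
  by_cases h : j ∈ ω.1 <;> simp [h]

instance (γ : ℝ) (v : ℝ≥0) : IsProbabilityMeasure (csgmRandomness n (Fin d) γ v) := by
  unfold csgmRandomness; infer_instance

lemma integrable_preselect (hc : 0 < c) (hx : ∀ i, x i ∈ signCube d c) (v : ℝ≥0) (j : Fin d) :
    Integrable (fun ω => preselect c b d' x ω j) (preselectRandomness n d d' (b / d') v) := by
  simp_rw [preselect_eq_mul_estimate hc hx]
  exact Integrable.mul_prod (f := fun J : Finset (Fin d) => d / d' * if j ∈ J then (1 : ℝ) else 0)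
    Integrable.of_finite ((memLp_estimate x j v).integrable one_le_two)

lemma integral_preselect (hc : 0 < c) (hx : ∀ i, x i ∈ signCube d c) (hn : 0 < n) (hd : 1 ≤ d)
    (hd' : 1 ≤ d') (hdd : d' ≤ d) (h0 : 0 < b / d') (h1 : b / d' ≤ 1) (v : ℝ≥0) (j : Fin d) :
    ∫ ω, preselect c b d' x ω j ∂preselectRandomness n d d' (b / d') v = mean x j := by
  simp_rw [preselect_eq_mul_estimate hc hx]
  have hd0 : (0 : ℝ) < d := by exact_mod_cast hd
  have hd0' : (0 : ℝ) < d' := by exact_mod_cast hd'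
  rw [preselectRandomness, integral_prod_mul
    (fun J : Finset (Fin d) => d / d' * if j ∈ J then (1 : ℝ) else 0), integral_estimate x j hn h0 h1,
    integral_const_mul, integral_indicator_mem hd hdd]
  field_simp

lemma integrable_preselect_sub_sq (hc : 0 < c) (hx : ∀ i, x i ∈ signCube d c) (v : ℝ≥0)
    (m : ℝ) (j : Fin d) :
    Integrable (fun ω => (preselect c b d' x ω j - m) ^ 2)
      (preselectRandomness n d d' (b / d') v) := by
  have h2 : Integrable (fun ω => (preselect c b d' x ω j) ^ 2)
      (preselectRandomness n d d' (b / d') v) := by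
    simp_rw [preselect_eq_mul_estimate hc hx, mul_pow]
    exact Integrable.mul_prod
      (f := fun J : Finset (Fin d) => (d / d' : ℝ) ^ 2 * (if j ∈ J then (1 : ℝ) else 0) ^ 2)
      Integrable.of_finite (memLp_estimate x j v).integrable_sq
  have e : ∀ ω, (preselect c b d' x ω j - m) ^ 2
      = preselect c b d' x ω j ^ 2 - 2 * m * preselect c b d' x ω j + m ^ 2 := fun ω => by ring
  simp_rw [e]
  have : IsFiniteMeasure (preselectRandomness n d d' (b / d') v) := by
    unfold preselectRandomness uniformOn; infer_instance
  exact (h2.sub ((integrable_preselect hc hx v j).const_mul _)).add (integrable_const _)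

/-- The output is `ξ·Y` with `ξ = (d/d')·1[j ∈ J]` independent of the estimate `Y`, `E ξ = 1` and `E
ξ² = d/d'`. The last term is the variance due to pre-selection alone. -/
lemma integral_preselect_sub_sq (hc : 0 < c) (hx : ∀ i, x i ∈ signCube d c) (hn : 0 < n)
    (hd : 1 ≤ d) (hd' : 1 ≤ d') (hdd : d' ≤ d) (h0 : 0 < b / d') (h1 : b / d' ≤ 1) (v : ℝ≥0)
    (j : Fin d) :
    ∫ ω, (preselect c b d' x ω j - mean x j) ^ 2 ∂preselectRandomness n d d' (b / d') v
      = d / d' * (c ^ 2 * (1 - b / d') / (n * (b / d')) + v) + (d / d' - 1) * mean x j ^ 2 := by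
  have hd0 : (0 : ℝ) < d := by exact_mod_cast hd
  have hd0' : (0 : ℝ) < d' := by exact_mod_cast hd'
  have hU := isProbabilityMeasure_uniformOn_card hdd
  have : IsProbabilityMeasure (preselectRandomness n d d' (b / d') v) := by
    unfold preselectRandomness; infer_instance
  have h2 : Integrable (fun ω => (preselect c b d' x ω j) ^ 2)
      (preselectRandomness n d d' (b / d') v) := by
    simpa using integrable_preselect_sub_sq (d' := d') (b := b) hc hx v 0 j
  have i2 : ∫ ω, preselect c b d' x ω j ^ 2 ∂preselectRandomness n d d' (b / d') v
      = d / d' * (mean x j ^ 2 + c ^ 2 * (1 - b / d') / (n * (b / d')) + v) := by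
    have e : ∀ ω : Coins n d, preselect c b d' x ω j ^ 2
        = ((d / d' : ℝ) ^ 2 * if j ∈ ω.1 then (1 : ℝ) else 0) * estimate (b / d') x j ω.2 ^ 2 := by
      intro ω
      rw [preselect_eq_mul_estimate hc hx]
      by_cases h : j ∈ ω.1 <;> simp [h, mul_pow]
    simp_rw [e]
    rw [preselectRandomness, integral_prod_mul
      (fun J : Finset (Fin d) => (d / d' : ℝ) ^ 2 * if j ∈ J then (1 : ℝ) else 0)
      (fun p => estimate (b / d') x j p ^ 2), integral_estimate_sq x j hn h0 h1 v hx,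
      integral_const_mul, integral_indicator_mem hd hdd]
    congr 1
    field_simp
  have e : ∀ ω, (preselect c b d' x ω j - mean x j) ^ 2
      = preselect c b d' x ω j ^ 2 - 2 * mean x j * preselect c b d' x ω j + mean x j ^ 2 :=
    fun ω => by ring
  simp_rw [e]
  have hi := (integrable_preselect (b := b) (d' := d') hc hx v j).const_mul (2 * mean x j)
  have hs : Integrable (fun ω => preselect c b d' x ω j ^ 2
      - 2 * mean x j * preselect c b d' x ω j) (preselectRandomness n d d' (b / d') v) := h2.sub hi
  rw [integral_add hs (integrable_const _), integral_sub h2 hi, i2, integral_const_mul,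
    integral_preselect hc hx hn hd hd' hdd h0 h1, integral_const, probReal_univ, one_smul]
  ring

lemma mean_sq_le (hc : 0 < c) (hx : ∀ i, x i ∈ signCube d c) (hn : 0 < n) (j : Fin d) :
    mean x j ^ 2 ≤ c ^ 2 := by
  have hn' : (0 : ℝ) < n := by exact_mod_cast hn
  apply sq_le_sq'
  · rw [mean, one_div, ← div_eq_inv_mul, le_div_iff₀ hn']
    have : ∑ _i : Fin n, (-c) ≤ ∑ i, x i j := Finset.sum_le_sum fun i _ => by
      rcases hx i j with h | h <;> rw [h]; linarith
    simp at this; linarith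
  · rw [mean, one_div, ← div_eq_inv_mul, div_le_iff₀ hn']
    have : ∑ i, x i j ≤ ∑ _i : Fin n, c := Finset.sum_le_sum fun i _ => by
      rcases hx i j with h | h <;> rw [h]; linarith
    simp at this; linarith

lemma integral_sq_error_le (hc : 0 < c) (hx : ∀ i, x i ∈ signCube d c) (hn : 0 < n)
    (hd : 1 ≤ d) (hd' : 1 ≤ d') (hdd : d' ≤ d) (h0 : 0 < b / d') (h1 : b / d' ≤ 1) (v : ℝ≥0) :
    ∫ ω, ∑ j, (preselect c b d' x ω j - mean x j) ^ 2 ∂preselectRandomness n d d' (b / d') v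
      ≤ d ^ 2 / d' * (c ^ 2 / (n * (b / d')) + v) + d * (d / d' - 1) * c ^ 2 := by
  have hd0 : (0 : ℝ) < d := by exact_mod_cast hd
  have hd0' : (0 : ℝ) < d' := by exact_mod_cast hd'
  have hn' : (0 : ℝ) < n := by exact_mod_cast hn
  have hr : (0 : ℝ) ≤ d / d' - 1 := by
    rw [sub_nonneg, one_le_div hd0']; exact_mod_cast hdd
  rw [integral_finsetSum _ fun j _ => integrable_preselect_sub_sq hc hx v _ j]
  calc _ ≤ ∑ _j : Fin d, (d / d' * (c ^ 2 / (n * (b / d')) + v) + (d / d' - 1) * c ^ 2) := by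
        refine Finset.sum_le_sum fun j _ => ?_
        rw [integral_preselect_sub_sq hc hx hn hd hd' hdd h0 h1]
        have := mean_sq_le hc hx hn j
        gcongr
        nlinarith [sq_nonneg c]
    _ = _ := by
        rw [Finset.sum_const, Finset.card_univ, Fintype.card_fin, nsmul_eq_mul]; ring

lemma bitCount_preselectMessage (x : Fin n → Fin d → ℝ) (ω : Coins n d) (i : Fin n) :
    (bitCount (preselectMessage x ω i) : ℝ)
      = ∑ j, (if j ∈ ω.1 then (1 : ℝ) else 0) * if ω.2.1 i j then (1 : ℝ) else 0 := by
  have e : ∀ k : {j // j ∈ ω.1}, (preselectMessage x ω i k).isSome = true ↔ ω.2.1 i k = true := by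
    intro k
    unfold preselectMessage message
    by_cases h : ω.2.1 i k <;> simp [h]
  rw [bitCount, Finset.card_filter]
  simp_rw [e]
  push_cast
  rw [Finset.sum_coe_sort ω.1 (fun j => if ω.2.1 i j = true then (1 : ℝ) else 0)]
  simp_rw [ite_mul, one_mul, zero_mul]
  rw [Finset.sum_ite_mem, Finset.univ_inter]

lemma integrable_bitCount (x : Fin n → Fin d → ℝ) (γ : ℝ) (v : ℝ≥0) (i : Fin n) :
    Integrable (fun ω => (bitCount (preselectMessage x ω i) : ℝ))
      (preselectRandomness n d d' γ v) := by
  simp_rw [bitCount_preselectMessage]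
  refine integrable_finsetSum _ fun j _ => ?_
  refine Integrable.mul_prod (f := fun J : Finset (Fin d) => if j ∈ J then (1 : ℝ) else 0)
    (g := fun p : (Fin n → Fin d → Bool) × (Fin d → ℝ) => if p.1 i j then (1 : ℝ) else 0)
    Integrable.of_finite ?_
  exact Integrable.comp_fst (f := fun z : Fin n → Fin d → Bool => if z i j then (1 : ℝ) else 0)
    (Integrable.of_finite) _

lemma integral_bitCount (x : Fin n → Fin d → ℝ) {γ : ℝ} (h0 : 0 ≤ γ) (h1 : γ ≤ 1) (hd : 1 ≤ d)
    (hdd : d' ≤ d) (v : ℝ≥0) (i : Fin n) :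
    ∫ ω, (bitCount (preselectMessage x ω i) : ℝ) ∂preselectRandomness n d d' γ v = d' * γ := by
  have hd0 : (0 : ℝ) < d := by exact_mod_cast hd
  simp_rw [bitCount_preselectMessage]
  have hg : ∀ j, Integrable (fun p : (Fin n → Fin d → Bool) × (Fin d → ℝ) =>
      if p.1 i j then (1 : ℝ) else 0) (csgmRandomness n (Fin d) γ v) := fun j =>
    Integrable.comp_fst (f := fun z : Fin n → Fin d → Bool => if z i j then (1 : ℝ) else 0)
      (Integrable.of_finite) _
  rw [preselectRandomness, integral_finsetSum _ fun j _ => Integrable.mul_prod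
    (f := fun J : Finset (Fin d) => if j ∈ J then (1 : ℝ) else 0) Integrable.of_finite (hg j)]
  have : ∀ j, ∫ ω : Coins n d, (if j ∈ ω.1 then (1 : ℝ) else 0) * (if ω.2.1 i j then (1 : ℝ) else 0)
      ∂((uniformOn {J : Finset (Fin d) | J.card = d'}).prod (csgmRandomness n (Fin d) γ v))
      = d' / d * γ := by
    intro j
    rw [integral_prod_mul (fun J : Finset (Fin d) => if j ∈ J then (1 : ℝ) else 0)
      (fun p : (Fin n → Fin d → Bool) × (Fin d → ℝ) => if p.1 i j then (1 : ℝ) else 0),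
      integral_indicator_mem hd hdd, csgmRandomness, integral_fun_fst
      (fun z : Fin n → Fin d → Bool => if z i j then (1 : ℝ) else 0),
      integral_selection j h0 h1]
    simp
  simp_rw [this]
  rw [Finset.sum_const, Finset.card_univ, Fintype.card_fin, nsmul_eq_mul]
  field_simp

end Preselect

/-! ### Bounds on the noise level and choice of `d'`. -/

/-- This side of the minimum gives the claimed bound on `σ²`. The other side, `noiseScale_le'`,
gives the error bound, where only one logarithm may involve the dimension. -/
lemma noiseScale_le {A L Λ g ε : ℝ} (hA : 0 ≤ A) (hL : 0 ≤ L) (hLΛ : L ≤ Λ) (hg : 0 ≤ g) :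
    noiseScale A L Λ g ε ≤ 2 * A * (L + g * Λ * (Λ + ε)) := by
  have hΛ : 0 ≤ Λ := hL.trans hLΛ
  have h1 : min Λ (L + g * Λ * (Λ + ε)) ≤ L + g * Λ * (Λ + ε) := min_le_right _ _
  have h2 : g * Λ * (L + ε) ≤ g * Λ * (Λ + ε) := by gcongr
  calc noiseScale A L Λ g ε ≤ A * (2 * (L + g * Λ * (Λ + ε))) :=
        mul_le_mul_of_nonneg_left (by linarith) hA
    _ = _ := by ring

lemma noiseScale_le' {A L Λ g ε : ℝ} (hA : 0 ≤ A) :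
    noiseScale A L Λ g ε ≤ A * (Λ + g * Λ * (L + ε)) := by
  unfold noiseScale
  gcongr
  exact min_le_left _ _

lemma le_noiseScale {A L Λ g ε : ℝ} (hA : 0 ≤ A) (hL : 0 ≤ L) (hLΛ : L ≤ Λ) (hg : 0 ≤ g)
    (hε : 0 < ε) : A * L ≤ noiseScale A L Λ g ε := by
  have hΛ : 0 ≤ Λ := hL.trans hLΛ
  have h1 : L ≤ min Λ (L + g * Λ * (Λ + ε)) :=
    le_min hLΛ (by linarith [show 0 ≤ g * Λ * (Λ + ε) by positivity])
  unfold noiseScale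
  gcongr
  linarith [show 0 ≤ g * Λ * (L + ε) by positivity]

/-- The rounded number of coordinates is at most twice `n b`, and either all coordinates are used
or it is at least half of the smaller of the other two terms of the minimum. -/
lemma round_bounds {k D N E : ℝ} (hk : 1 ≤ k) (hN : 1 ≤ N) (hE : 0 < E)
    (hkD : k = D ∨ k + 1 ≤ D) (h : |k - min D (min N E)| < 1) :
    k ≤ 2 * N ∧ (k = D ∨ 1 / k ≤ 2 * max (1 / N) (1 / E)) := by
  rw [abs_lt] at h
  refine ⟨?_, ?_⟩
  · have : min D (min N E) ≤ N := (min_le_right _ _).trans (min_le_left _ _)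
    linarith
  · rcases hkD with hkD | hkD
    · exact Or.inl hkD
    · right
      -- A `k` with `k + 1 ≤ D` is not within distance less than `1` of `D`, so `D` is not the
      -- minimum.
      have hm : min D (min N E) = min N E := by
        rcases le_total D (min N E) with h' | h'
        · rw [min_eq_left h'] at h; linarith
        · exact min_eq_right h'
      rw [hm] at h
      have hm0 : 0 < min N E := lt_min (by linarith) hE
      have h2 : 1 / k ≤ 2 * (1 / min N E) := by
        rw [mul_one_div, div_le_div_iff₀ (by linarith) hm0]; linarith
      refine h2.trans ?_
      gcongr
      rcases min_choice N E with h' | h' <;> rw [h']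
      · exact le_max_left _ _
      · exact le_max_right _ _

/-- The three contributions to the squared error. -/
lemma sq_error_bound {n k d b c ε L Λ Λd A l0 v : ℝ} (hn : 0 < n) (hb : 0 < b) (hk : 1 ≤ k)
    (hd : 0 < d) (hε : 0 < ε) (hl0 : 0 < l0) (hL : l0 ≤ L) (hLΛ : L ≤ Λ)
    (hΛ : Λ ≤ Λd) (hA : 0 ≤ A) (hk1 : k ≤ 2 * (n * b))
    (hk2 : k = d ∨ 1 / k ≤ 2 * max (1 / (n * b))
      (1 / (n ^ 2 * ε ^ 2 / ((L + ε) * Λd))))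
    (hv : v = c ^ 2 / (n ^ 2 * (b / k) ^ 2) * noiseScale A L Λ ((b / k) ^ 2 * k / ε ^ 2) ε) :
    d ^ 2 / k * (c ^ 2 / (n * (b / k)) + v) + d * (d / k - 1) * c ^ 2
      ≤ (3 / l0 + 2 + 3 * A) * (c ^ 2 * d ^ 2 * Λd
        * max (1 / (n * b)) ((L + ε) / (n ^ 2 * ε ^ 2))) := by
  have hL0 : 0 < L := hl0.trans_le hL
  have hΛ0 : 0 < Λ := hL0.trans_le hLΛ
  have hΛd0 : 0 < Λd := hΛ0.trans_le hΛ
  have hk0 : 0 < k := by linarith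
  set m := max (1 / (n * b)) ((L + ε) / (n ^ 2 * ε ^ 2)) with hm
  have hm1 : 1 / (n * b) ≤ m := le_max_left _ _
  have hm2 : (L + ε) / (n ^ 2 * ε ^ 2) ≤ m := le_max_right _ _
  have hm0 : 0 < m := lt_of_lt_of_le (by positivity) hm1
  have hΛl : 1 ≤ 1 / l0 * Λd := by
    rw [one_div, ← div_eq_inv_mul, one_le_div hl0]; linarith
  have t1 : d ^ 2 / k * (c ^ 2 / (n * (b / k))) ≤ 1 / l0 * (c ^ 2 * d ^ 2 * Λd * m) := by
    calc d ^ 2 / k * (c ^ 2 / (n * (b / k))) = c ^ 2 * d ^ 2 * (1 / (n * b)) := by field_simp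
      _ ≤ c ^ 2 * d ^ 2 * m := by gcongr
      _ ≤ (c ^ 2 * d ^ 2 * m) * (1 / l0 * Λd) := le_mul_of_one_le_right (by positivity) hΛl
      _ = _ := by ring
  have t2 : d ^ 2 / k * v ≤ 3 * A * (c ^ 2 * d ^ 2 * Λd * m) := by
    calc d ^ 2 / k * v ≤ d ^ 2 / k * (c ^ 2 / (n ^ 2 * (b / k) ^ 2)
          * (A * (Λ + (b / k) ^ 2 * k / ε ^ 2 * Λ * (L + ε)))) := by
            rw [hv]
            gcongr
            exact noiseScale_le' hA
      _ = A * (c ^ 2 * d ^ 2) * Λ * (k / (n * b) * (1 / (n * b))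
          + (L + ε) / (n ^ 2 * ε ^ 2)) := by field_simp
      _ ≤ A * (c ^ 2 * d ^ 2) * Λd * (2 * m + m) := by
          -- The cap `d' ≤ 2nb` keeps the part `Λ/(nγ)²` of the noise variance at the order of
          -- `1/(nb)`.
          have : k / (n * b) ≤ 2 := by rw [div_le_iff₀ (by positivity)]; exact hk1
          gcongr
      _ = _ := by ring
  have t3 : d * (d / k - 1) * c ^ 2 ≤ (2 / l0 + 2) * (c ^ 2 * d ^ 2 * Λd * m) := by
    rcases hk2 with h | h
    · rw [h, div_self hd.ne', sub_self, mul_zero, zero_mul]; positivity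
    -- The factor `log (d/δ)` in the third term of the minimum defining `d'` is the one allowed in
    -- the error bound.
    · have e : 1 / (n ^ 2 * ε ^ 2 / ((L + ε) * Λd)) = Λd * ((L + ε) / (n ^ 2 * ε ^ 2)) := by
        field_simp
      rw [e] at h
      have h' : 1 / k ≤ 2 * (1 / l0 * Λd * m + Λd * m) := by
        refine h.trans ?_
        gcongr
        refine max_le ?_ ?_
        · have : m ≤ 1 / l0 * Λd * m := le_mul_of_one_le_left hm0.le hΛl
          have : 0 ≤ Λd * m := by positivity
          linarith
        · have : 0 ≤ 1 / l0 * Λd * m := by positivity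
          have : Λd * ((L + ε) / (n ^ 2 * ε ^ 2)) ≤ Λd * m := by gcongr
          linarith
      calc d * (d / k - 1) * c ^ 2 = d ^ 2 * c ^ 2 * (1 / k) - d * c ^ 2 := by field_simp
        _ ≤ d ^ 2 * c ^ 2 * (1 / k) := by linarith [show 0 ≤ d * c ^ 2 by positivity]
        _ ≤ d ^ 2 * c ^ 2 * (2 * (1 / l0 * Λd * m + Λd * m)) := by gcongr
        _ = _ := by ring
  calc _ = d ^ 2 / k * (c ^ 2 / (n * (b / k))) + d ^ 2 / k * v + d * (d / k - 1) * c ^ 2 := by ring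
    _ ≤ 1 / l0 * (c ^ 2 * d ^ 2 * Λd * m) + 3 * A * (c ^ 2 * d ^ 2 * Λd * m)
        + (2 / l0 + 2) * (c ^ 2 * d ^ 2 * Λd * m) := by gcongr
    _ = _ := by ring

end CSGM

theorem mainTheorem8 (δ₀ : ℝ) (hδ₀ : δ₀ < 1) :
    ∃ A C : ℝ, 0 < A ∧ 0 < C ∧
      ∀ (n d : ℕ) (b c ε δ : ℝ) (d' : ℕ),
        1 ≤ n → 1 ≤ d → 1 ≤ n * b → 0 < c → 0 < ε → 0 < δ → δ ≤ δ₀ →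
        -- `d'` is the minimum below, rounded up or down to an integer in `[1, d]`
        1 ≤ d' → d' ≤ d →
        |(d' : ℝ) - min (d : ℝ) (min (n * b)
            (n ^ 2 * ε ^ 2 / ((Real.log (1 / δ) + ε) * Real.log (d / δ))))| < 1 →
        -- the sampling parameter `γ = b / d'` is a probability
        b ≤ d' →
        ∃ v : ℝ≥0,
          (v : ℝ) ≤ A * (c ^ 2 * Real.log (1 / δ) / (n ^ 2 * (b / d') ^ 2) +
            c ^ 2 * d' * (Real.log (d' / δ) + ε) * Real.log (d' / δ) / (n ^ 2 * ε ^ 2)) ∧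
          -- differential privacy
          CSGM.IsDP ε δ (CSGM.preselectRandomness n d d' (b / d') v)
            (fun x : Fin n → CSGM.signCube d c =>
              CSGM.preselect c b d' (fun i => (x i : Fin d → ℝ))) ∧
          ∀ x : Fin n → Fin d → ℝ, (∀ i, x i ∈ CSGM.signCube d c) →
            -- unbiasedness
            (∀ j, Integrable (fun ω => CSGM.preselect c b d' x ω j)
                (CSGM.preselectRandomness n d d' (b / d') v) ∧
              ∫ ω, CSGM.preselect c b d' x ω j ∂(CSGM.preselectRandomness n d d' (b / d') v) =
                CSGM.mean x j) ∧
            -- expected number of bits sent by each client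
            (∀ i, Integrable (fun ω => (CSGM.bitCount (CSGM.preselectMessage x ω i) : ℝ))
                (CSGM.preselectRandomness n d d' (b / d') v) ∧
              ∫ ω, (CSGM.bitCount (CSGM.preselectMessage x ω i) : ℝ)
                ∂(CSGM.preselectRandomness n d d' (b / d') v) = b) ∧
            -- squared Euclidean error
            Integrable (fun ω => ∑ j, (CSGM.preselect c b d' x ω j - CSGM.mean x j) ^ 2)
                (CSGM.preselectRandomness n d d' (b / d') v) ∧
              ∫ ω, ∑ j, (CSGM.preselect c b d' x ω j - CSGM.mean x j) ^ 2
                ∂(CSGM.preselectRandomness n d d' (b / d') v) ≤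
              C * (c ^ 2 * d ^ 2 * Real.log (d / δ) *
                max (1 / (n * b)) ((Real.log (1 / δ) + ε) / (n ^ 2 * ε ^ 2))) := by
  open CSGM in
  -- For `δ₀ ≤ 0` no `δ` is admissible, so any constants work.
  rcases le_or_gt δ₀ 0 with hneg | hδ₀pos
  · refine ⟨1, 1, one_pos, one_pos, fun n d b c ε δ d' _ _ _ _ _ hδ hδδ₀ => ?_⟩
    exact absurd (hδ.trans_le hδδ₀) (not_lt.2 hneg)
  set l0 := Real.log (1 / δ₀) with hl0def
  have hl0 : 0 < l0 := Real.log_pos (by rw [lt_div_iff₀ hδ₀pos]; linarith)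
  obtain ⟨A, hA, htrunc⟩ := exists_truncation hl0
  refine ⟨2 * A, 3 / l0 + 2 + 3 * A, by positivity, by positivity, ?_⟩
  intro n d b c ε δ d' hn hd hnb hc hε hδ hδδ₀ hd' hdd hround hbd
  have hn0 : (0 : ℝ) < n := by exact_mod_cast hn
  have hk1 : (1 : ℝ) ≤ d' := by exact_mod_cast hd'
  have hk0 : (0 : ℝ) < d' := by linarith
  have hd0 : (0 : ℝ) < d := by exact_mod_cast hd
  have hkd : (d' : ℝ) ≤ d := by exact_mod_cast hdd
  have hb : 0 < b := by
    by_contra h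
    have := mul_nonpos_of_nonneg_of_nonpos hn0.le (not_lt.1 h)
    linarith
  have hγ0 : 0 < b / (d' : ℝ) := by positivity
  have hγ1 : b / (d' : ℝ) ≤ 1 := (div_le_one hk0).2 hbd
  have hL : l0 ≤ Real.log (1 / δ) := by
    rw [hl0def]
    exact Real.log_le_log (by positivity) (by gcongr)
  have hL0 : 0 < Real.log (1 / δ) := hl0.trans_le hL
  have hLΛ : Real.log (1 / δ) ≤ Real.log (d' / δ) :=
    Real.log_le_log (by positivity) (by gcongr)
  have hΛΛ : Real.log (d' / δ) ≤ Real.log (d / δ) :=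
    Real.log_le_log (by positivity) (by gcongr)
  set L := Real.log (1 / δ) with hLdef
  set Λ := Real.log (d' / δ) with hΛdef
  set Λd := Real.log (d / δ) with hΛddef
  have hΛ0 : 0 < Λ := hL0.trans_le hLΛ
  have hΛd0 : 0 < Λd := hΛ0.trans_le hΛΛ
  set g := (b / d') ^ 2 * d' / ε ^ 2 with hg
  have hg0 : 0 < g := by positivity
  set T := noiseScale A L Λ g ε with hT
  have hT0 : 0 < T := lt_of_lt_of_le (by positivity) (le_noiseScale hA.le hL0.le hLΛ hg0.le hε)
  -- Chosen so that the rescaled variance `(c/(nγ))²/v` is exactly `1/T`, as `exists_truncation`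
  -- requires.
  set vr : ℝ := c ^ 2 / (n ^ 2 * (b / d') ^ 2) * T with hvr
  have hvr0 : 0 < vr := by positivity
  set v : ℝ≥0 := ⟨vr, hvr0.le⟩ with hv
  have hvc : (v : ℝ) = vr := rfl
  have hv0 : v ≠ 0 := by
    intro h
    have : (v : ℝ) = 0 := by rw [h]; rfl
    rw [hvc] at this; exact hvr0.ne' this
  set w : ℝ≥0 := ⟨1 / T, by positivity⟩ with hw
  have hwc : (w : ℝ) = 1 / T := rfl
  obtain ⟨R, l, η, κ, hl, hη0, hκ0, hη, hκ, hfin⟩ :=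
    htrunc d' (b / d') ε δ w hd' hγ0 hγ1 hε hδ hL (by
      rw [hwc, ← hLdef, ← hΛdef, ← hg, ← hT]; field_simp)
  obtain ⟨hr1, hr2⟩ := round_bounds hk1 hnb
    (show 0 < (n : ℝ) ^ 2 * ε ^ 2 / ((L + ε) * Λd) by positivity)
    (show (d' : ℝ) = d ∨ (d' : ℝ) + 1 ≤ d by
      rcases hdd.eq_or_lt with h | h
      · left; rw [h]
      · right; exact_mod_cast h) hround
  refine ⟨v, ?_, ?_, fun x hx => ⟨fun j => ⟨integrable_preselect hc hx v j,
    integral_preselect hc hx hn hd hd' hdd hγ0 hγ1 v j⟩, fun i => ⟨integrable_bitCount x _ v i, ?_⟩,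
    integrable_finsetSum _ fun j _ => integrable_preselect_sub_sq hc hx v _ j, ?_⟩⟩
  · rw [hvc, hvr]
    calc c ^ 2 / (n ^ 2 * (b / d') ^ 2) * T
        ≤ c ^ 2 / (n ^ 2 * (b / d') ^ 2) * (2 * A * (L + g * Λ * (Λ + ε))) := by
          gcongr
          exact noiseScale_le hA.le hL0.le hLΛ hg0.le
      _ = _ := by rw [hg]; field_simp
  · refine preselect_isDP hc hdd hγ0 hγ1 hv0 ?_ hl hη0 hκ0 hη hκ hfin
    rw [hwc, hvc, hvr]
    field_simp
  · rw [integral_bitCount x hγ0.le hγ1 hd hdd v i]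
    field_simp
  · refine (integral_sq_error_le hc hx hn hd hd' hdd hγ0 hγ1 v).trans ?_
    exact sq_error_bound hn0 hb hk1 hd0 hε hl0 hL hLΛ hΛΛ hA.le hr1 hr2 (by rw [hvc])
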